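/- **Setting.** Let $I\subseteq[0,\infty)$ be an interval containing $0$. Let $s,\sigma:I\to\mathbb R$ be continuous, and continuously differentiable in the interior of $I$, with $s>0$, $s(0)=1$, $\sigma(0)=0$ and $\sigma$ strictly increasing. Consider on $\mathbb R^d$ the SDE $$dX_t=\frac{\dot s(t)}{s(t)}X_t\,dt+s(t)\sqrt{2\dot\sigma(t)\sigma(t)}\,dW_t ,\qquad t\in I ,$$ and a forward solution kernel $p(x_t\mid x_0)$ of it, i.e. for each $x_0$ a weak solution, in probability measures, of the associated Fokker–Planck equation that starts from $\delta_{x_0}$. Let $p_0$ be a probability measure on $\mathbb R^d$ with $\int\|x\|^2\,dp_0<\infty$ that is absolutely continuous with respect to a $\sigma$-finite reference measure $\nu$ (Lebesgue measure for continuous data; counting measure on a countable set for discrete data), with finite entropy: $\log\frac{dp_0}{d\nu}\in L^1(p_0)$. Let $x_0\sim p_0$ and, given $x_0$, $x_t\sim p(x_t\mid x_0)$. Put $$\mathbf H[x_0|x_t]=-\mathbb E\big[\log p(x_0\mid x_t)\big],$$ where $p(x_0\mid x_t)$ is the conditional density of $x_0$ given $x_t$ with respect to $\nu$. Let $J=I\cap(0,\infty)$;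 if $\nu$ is the counting measure on a countable set, one may also take $J=I$. A function is a *proper time change* on a set of times if it is continuous and strictly increasing there. **Theorem.** For $t\in J$ the function $\log p(x_0|x_t)$ is integrable, so that $\mathbf H[x_0|x_t]$ is well defined and finite; $t\mapsto\mathbf H[x_0|x_t]$ is differentiable in the interior of $I$; and $\tau\mapsto\sigma(\tau)\dot{\mathbf H}[x_0|x_\tau]$ is integrable on $[0,t]$ for every $t\in I$. The functions $$\phi(t)=\mathbf H[x_0|x_t]\quad(t\in J)\qquad\text{and}\qquad \phi(t)=\int_0^t\sigma(\tau)\,\dot{\mathbf H}[x_0|x_\tau]\,d\tau\quad(t\in I)$$ are continuous and nondecreasing, and if $p_0$ is not a point mass, then they are strictly increasing, so that they are proper time changes on $J$ and on $I$, respectively. -/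

import Mathlib

open MeasureTheory ProbabilityTheory Set
open scoped ContDiff ENNReal Laplacian

/-- A proper time change on a set `J` of times: continuous and strictly increasing. -/
def IsProperTimeChange (φ : ℝ → ℝ) (J : Set ℝ) : Prop :=
  ContinuousOn φ J ∧ StrictMonoOn φ J

/-- The generator `⟨b(x, t), ∇f(x)⟩ + (g(t)² / 2) Δf(x)` of the stochastic differential equation
`dX = b(X, t) dt + g(t) dW`; the Fokker-Planck operator is its formal adjoint. -/
noncomputable def sdeGenerator {d : ℕ}
    (b : EuclideanSpace ℝ (Fin d) → ℝ → EuclideanSpace ℝ (Fin d)) (g : ℝ → ℝ) (t : ℝ)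
    (f : EuclideanSpace ℝ (Fin d) → ℝ) (x : EuclideanSpace ℝ (Fin d)) : ℝ :=
  fderiv ℝ f x (b x t) + g t ^ 2 / 2 * Δ f x

/-- `K t x₀ = p(x_t | x₀)` is a forward solution kernel, on the time interval `I ∋ 0`, of the
equation `dX = b(X, t) dt + g(t) dW`: for every starting point `x₀`, the probability measures
`K t x₀` start from the point mass at `x₀` and solve the Fokker-Planck equation
`∂ₜ p = ∑ⱼ ∂ⱼ (- bⱼ + (g² / 2) ∂ⱼ) p` weakly, i.e. when tested against smooth compactly supported
functions. -/
structure IsForwardKernel {d : ℕ} (I : Set ℝ)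
    (b : EuclideanSpace ℝ (Fin d) → ℝ → EuclideanSpace ℝ (Fin d)) (g : ℝ → ℝ)
    (K : ℝ → Kernel (EuclideanSpace ℝ (Fin d)) (EuclideanSpace ℝ (Fin d))) : Prop where
  markov : ∀ t ∈ I, IsMarkovKernel (K t)
  initial : ∀ x₀, K 0 x₀ = Measure.dirac x₀
  continuousOn : ∀ x₀, ∀ f : EuclideanSpace ℝ (Fin d) → ℝ, ContDiff ℝ ∞ f → HasCompactSupport f →
    ContinuousOn (fun t => ∫ x, f x ∂(K t x₀)) I
  fokkerPlanck : ∀ x₀, ∀ f : EuclideanSpace ℝ (Fin d) → ℝ, ContDiff ℝ ∞ f → HasCompactSupport f →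
    ∀ t ∈ interior I,
      HasDerivAt (fun t => ∫ x, f x ∂(K t x₀)) (∫ x, sdeGenerator b g t f x ∂(K t x₀)) t

/-- A scaling `s` and a noise level `σ` on the time interval `I ∋ 0`. -/
structure IsNoiseSchedule (I : Set ℝ) (s σ : ℝ → ℝ) : Prop where
  s_zero : s 0 = 1
  s_pos : ∀ t ∈ I, 0 < s t
  s_continuousOn : ContinuousOn s I
  s_contDiffOn : ContDiffOn ℝ 1 s (interior I)
  σ_zero : σ 0 = 0
  σ_strictMonoOn : StrictMonoOn σ I
  σ_continuousOn : ContinuousOn σ I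
  σ_contDiffOn : ContDiffOn ℝ 1 σ (interior I)

/-- The drift `(s'(t) / s(t)) x`. -/
noncomputable def edmDrift {d : ℕ} (s : ℝ → ℝ) (x : EuclideanSpace ℝ (Fin d)) (t : ℝ) :
    EuclideanSpace ℝ (Fin d) :=
  (deriv s t / s t) • x

/-- The volatility `s(t) √(2 σ'(t) σ(t))`. -/
noncomputable def edmVolatility (s σ : ℝ → ℝ) (t : ℝ) : ℝ :=
  s t * √(2 * deriv σ t * σ t)

/-- The conditional density `p(x₀ | x_t) = p(x₀, x_t) / p(x_t)` of `x₀` with respect to the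
reference measure `ν`, as a function of the pair `(x₀, x_t)`, where `x₀` has law `p₀` and `x_t` has
conditional law `κ x₀`. Here `p₀ ⊗ₘ κ` is the joint law of `(x₀, x_t)` and `κ ∘ₘ p₀` is the law
of `x_t`. -/
noncomputable def denoisingDensity {d : ℕ} (ν p₀ : Measure (EuclideanSpace ℝ (Fin d)))
    (κ : Kernel (EuclideanSpace ℝ (Fin d)) (EuclideanSpace ℝ (Fin d))) :
    EuclideanSpace ℝ (Fin d) × EuclideanSpace ℝ (Fin d) → ℝ≥0∞ :=
  (p₀ ⊗ₘ κ).rnDeriv (ν.prod (κ ∘ₘ p₀))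

/-- The conditional entropy `H[x₀ | x_t] = - 𝔼 [log p(x₀ | x_t)]` with respect to the reference
measure `ν`: the differential entropy if `ν` is the Lebesgue measure, the Shannon entropy if `ν` is
the counting measure on a countable set. -/
noncomputable def condEntropy {d : ℕ} (ν p₀ : Measure (EuclideanSpace ℝ (Fin d)))
    (κ : Kernel (EuclideanSpace ℝ (Fin d)) (EuclideanSpace ℝ (Fin d))) : ℝ :=
  - ∫ z, Real.log (denoisingDensity ν p₀ κ z).toReal ∂(p₀ ⊗ₘ κ)

/-- The rescaled entropy `∫₀ᵗ σ(τ) H'(τ) dτ`, for the entropy `H` as a function of time. -/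
noncomputable def rescaledEntropy (σ H : ℝ → ℝ) (t : ℝ) : ℝ :=
  ∫ τ in (0 : ℝ)..t, σ τ * deriv H τ

/-! Dividing the process by `s` removes the drift: the law of `X_t / s(t)` solves the heat equation
in the time `σ² / 2`. Tested against a plane wave of frequency `ξ`, it acquires the factor
`exp(-‖ξ‖² σ² / 2)`, so its characteristic function is known and `K t x₀` must be the law of `s (x₀
+ σ z)` with `z` standard Gaussian (`IsForwardKernel.apply_eq_map`).

Put `λ = 1 / σ`. Observing `x_t` amounts to observing `λ a + z`, where `a` is the datum. By Bayes'
formula, the conditional density at the true datum is `ρ(a) exp(-‖z‖² / 2) / Z`, with `ρ = dp₀/dν`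
and `Z = ∫ exp(-‖λ (a - b) + z‖² / 2) dp₀(b)` the `evidence`. Hence the conditional entropy is the
mean of `log Z` up to a constant independent of time (`condEntropy_eq`), and only its dependence on
`λ` has to be studied.

The `λ`-derivative of `log Z` is minus the posterior mean of `⟨a - b, λ (a - b) + z⟩`. Given the
observation, the datum `a` and a replica `b` drawn from the posterior are exchangeable
(`measurePreserving_exchangeData`). Averaging over the exchange turns the mean of this inner product
into `λ D / 2`, where `D` is the mean of `‖a - b‖²` (`dispersion`); this is the I-MMSE identity.
Thus the entropy increases with `σ` at the rate `D / (2 σ³)`. Positivity of the posterior density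
gives `D > 0` unless `p₀` is a point mass.

The vector `λ (a - b)` is the difference of two noises, each with the second moment of a standard
Gaussian vector, so `λ² D` is bounded uniformly in `λ`. The factor `σ` in the rescaled entropy
leaves exactly `λ² D / 2` as the rate in `σ`. Its primitive `Φ` is therefore continuous down to zero
noise, and the rescaled entropy is `Φ (σ t) - Φ 0`. For discrete data, `Z` tends to `p₀{a} exp(-‖z‖²
/ 2)` as `λ → ∞`, and the entropy tends to its value 0 at time 0. -/

/-! ### Integrals of dilated test functions against moving measures. -/

section TestFunctions

open Filter Topology

variable {E : Type*} [NormedAddCommGroup E] [InnerProductSpace ℝ E]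

/-- The radial derivative `⟨∇f(y), y⟩`. -/
noncomputable def radialDeriv (f : E → ℝ) (y : E) : ℝ := fderiv ℝ f y y

theorem ContDiff.radialDeriv {f : E → ℝ} (hf : ContDiff ℝ ∞ f) : ContDiff ℝ ∞ (radialDeriv f) :=
  (hf.fderiv_right (m := ∞) (by simp)).clm_apply contDiff_id

theorem HasCompactSupport.radialDeriv {f : E → ℝ} (hf : HasCompactSupport f) :
    HasCompactSupport (radialDeriv f) :=
  (hf.fderiv ℝ).mono fun x hx h => hx (by simp [_root_.radialDeriv, h])

/-- Dilations parametrized by `Real.exp (-r)` form a one-parameter group, so each derivative in `r`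
is a radial derivative at the moving point. For compactly supported `f`, bounds on these are uniform
in `x` and `r`. -/
theorem hasDerivAt_comp_exp_neg_smul {f : E → ℝ} (hf : Differentiable ℝ f) (x : E) (r : ℝ) :
    HasDerivAt (fun r => f (Real.exp (-r) • x)) (-radialDeriv f (Real.exp (-r) • x)) r := by
  have h1 : HasDerivAt (fun r : ℝ => Real.exp (-r) • x) (-(Real.exp (-r) • x)) r := by
    simpa using ((hasDerivAt_neg r).exp).smul_const x
  exact ((hf (Real.exp (-r) • x)).hasFDerivAt.comp_hasDerivAt r h1).congr_deriv
    (by simp [radialDeriv])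

theorem abs_comp_exp_neg_smul_sub_le {f : E → ℝ} (hf : Differentiable ℝ f) {C : ℝ}
    (hC : ∀ y, |radialDeriv f y| ≤ C) (x : E) (a b : ℝ) :
    |f (Real.exp (-b) • x) - f (Real.exp (-a) • x)| ≤ C * |b - a| := by
  simpa using convex_univ.norm_image_sub_le_of_norm_hasDerivWithin_le
    (fun r _ => (hasDerivAt_comp_exp_neg_smul hf x r).hasDerivWithinAt)
    (fun r _ => by simpa using hC (Real.exp (-r) • x)) (mem_univ a) (mem_univ b)

/-- A second-order Taylor bound from two uses of the mean value inequality; the constant `C` instead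
of `C / 2` is good enough. -/
theorem abs_comp_exp_neg_smul_sub_add_le {f : E → ℝ} (hf : ContDiff ℝ ∞ f) {C : ℝ}
    (hC : ∀ y, |radialDeriv (radialDeriv f) y| ≤ C) (x : E) (a b : ℝ) :
    |f (Real.exp (-b) • x) - f (Real.exp (-a) • x) + (b - a) * radialDeriv f (Real.exp (-a) • x)|
      ≤ C * (b - a) ^ 2 := by
  have hC0 : 0 ≤ C := (abs_nonneg _).trans (hC 0)
  set c := radialDeriv f (Real.exp (-a) • x)
  have key := (convex_uIcc a b).norm_image_sub_le_of_norm_hasDerivWithin_le (C := C * |b - a|)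
    (f := fun r => f (Real.exp (-r) • x) + r * c)
    (fun r _ => ((hasDerivAt_comp_exp_neg_smul (hf.differentiable (by simp)) x r).add
      ((hasDerivAt_id r).mul_const c)).hasDerivWithinAt)
    (fun r hr => by
      have h := abs_comp_exp_neg_smul_sub_le (hf.radialDeriv.differentiable (by simp)) hC x r a
      have h' : |a - r| ≤ |b - a| := by
        rw [abs_sub_comm]; exact abs_sub_left_of_mem_uIcc hr
      simpa [add_comm, ← sub_eq_add_neg, c] using h.trans (by gcongr))
    left_mem_uIcc right_mem_uIcc
  calc _ = ‖f (Real.exp (-b) • x) + b * c - (f (Real.exp (-a) • x) + a * c)‖ := by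
        rw [Real.norm_eq_abs]; congr 1; ring
    _ ≤ _ := key
    _ = _ := by rw [Real.norm_eq_abs, mul_assoc, ← sq, sq_abs]

theorem HasCompactSupport.comp_pos_smul {F : Type*} [Zero F] {f : E → F} (hf : HasCompactSupport f)
    {c : ℝ} (hc : 0 < c) : HasCompactSupport fun x => f (c • x) :=
  hf.comp_homeomorph (Homeomorph.smulOfNeZero c hc.ne')

theorem HasCompactSupport.integrable_of_contDiff [MeasurableSpace E] [BorelSpace E] {f : E → ℝ}
    (hf : ContDiff ℝ ∞ f) (hfc : HasCompactSupport f) (μ : Measure E) [IsFiniteMeasure μ] :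
    Integrable f μ :=
  hf.continuous.integrable_of_hasCompactSupport hfc

variable [MeasurableSpace E] [BorelSpace E]

/-- Differentiation of `r ↦ ∫ f(e^{-ℓ(r)} x) dμᵣ(x)`, where both the test function and the measure
move. -/
theorem hasDerivAt_integral_comp_exp_neg_smul {μ : ℝ → Measure E} {ℓ : ℝ → ℝ} {t ℓ' a : ℝ}
    (hμ : ∀ᶠ r in 𝓝 t, IsProbabilityMeasure (μ r)) (hℓ : HasDerivAt ℓ ℓ' t)
    {f : E → ℝ} (hf : ContDiff ℝ ∞ f) (hfc : HasCompactSupport f)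
    (hA : HasDerivAt (fun r => ∫ x, f (Real.exp (-ℓ t) • x) ∂μ r) a t)
    (hB : DifferentiableAt ℝ (fun r => ∫ x, radialDeriv f (Real.exp (-ℓ t) • x) ∂μ r) t) :
    HasDerivAt (fun r => ∫ x, f (Real.exp (-ℓ r) • x) ∂μ r)
      (a - ℓ' * ∫ x, radialDeriv f (Real.exp (-ℓ t) • x) ∂μ t) t := by
  obtain ⟨C, hC⟩ := hfc.radialDeriv.radialDeriv.exists_bound_of_continuous
    hf.radialDeriv.radialDeriv.continuous
  have hint : ∀ {g : E → ℝ}, ContDiff ℝ ∞ g → HasCompactSupport g → ∀ (c : ℝ) (ρ : Measure E),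
      IsProbabilityMeasure ρ → Integrable (fun x => g (Real.exp c • x)) ρ := by
    intro g hg hgc c ρ _
    exact (hgc.comp_pos_smul (Real.exp_pos c)).integrable_of_contDiff
      (hg.comp (contDiff_const_smul _)) ρ
  set A := fun r => ∫ x, f (Real.exp (-ℓ t) • x) ∂μ r with hA_def
  set B := fun r => ∫ x, radialDeriv f (Real.exp (-ℓ t) • x) ∂μ r with hB_def
  set h := fun r => ∫ x, f (Real.exp (-ℓ r) • x) ∂μ r with h_def
  -- `R` is the Taylor remainder integrated against `μ r`. As `μ r` has mass one, it is quadratic in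
  -- `ℓ r - ℓ t` uniformly over the measures, so only the fixed test functions in `A` and `B`
  -- require regularity of `μ`.
  set R := fun r => h r - A r + (ℓ r - ℓ t) * B r with hR_def
  have hRle : ∀ᶠ r in 𝓝 t, ‖R r‖ ≤ C * ‖(ℓ r - ℓ t) ^ 2‖ := by
    filter_upwards [hμ] with r hr
    have e : R r = ∫ x, (f (Real.exp (-ℓ r) • x) - f (Real.exp (-ℓ t) • x)
        + (ℓ r - ℓ t) * radialDeriv f (Real.exp (-ℓ t) • x)) ∂μ r := by
      rw [integral_add (f := fun x => f (Real.exp (-ℓ r) • x) - f (Real.exp (-ℓ t) • x))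
        ((hint hf hfc _ _ hr).sub (hint hf hfc _ _ hr))
        ((hint hf.radialDeriv hfc.radialDeriv _ _ hr).const_mul _),
        integral_sub (hint hf hfc _ _ hr) (hint hf hfc _ _ hr), integral_const_mul]
    rw [e, Real.norm_of_nonneg (sq_nonneg _)]
    refine (norm_integral_le_of_norm_le_const (μ := μ r) (ae_of_all _ fun x => ?_)).trans_eq
      (by rw [probReal_univ, mul_one])
    exact abs_comp_exp_neg_smul_sub_add_le hf hC x (ℓ t) (ℓ r)
  have hR0 : R t = 0 := by simp [hR_def, h_def, hA_def]
  have hRd : HasDerivAt R 0 t := by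
    rw [hasDerivAt_iff_isLittleO]
    simp only [hR0, sub_zero, smul_zero]
    have h1 : (fun r => ℓ r - ℓ t) =O[𝓝 t] fun r => r - t := hℓ.isBigO_sub
    have h2 : (fun r => ℓ r - ℓ t) =o[𝓝 t] fun _ => (1 : ℝ) := by
      rw [Asymptotics.isLittleO_one_iff]
      simpa using (hℓ.continuousAt.tendsto.sub_const (ℓ t))
    have h3 : (fun r => (ℓ r - ℓ t) ^ 2) =o[𝓝 t] fun r => r - t := by
      simpa [sq] using h1.mul_isLittleO h2
    exact (Asymptotics.IsBigO.of_bound C hRle).trans_isLittleO h3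
  have hfin := (hRd.add hA).sub ((hℓ.sub_const (ℓ t)).mul hB.hasDerivAt)
  have e1 : h = (R + A) - (fun r => ℓ r - ℓ t) * B := by
    ext r; simp [hR_def]; ring
  rw [e1]
  refine hfin.congr_deriv ?_
  rw [hB_def]
  ring

theorem continuousWithinAt_integral_comp_exp_neg_smul {μ : ℝ → Measure E} {ℓ : ℝ → ℝ} {I : Set ℝ}
    {t : ℝ} (hμ : ∀ r ∈ I, IsProbabilityMeasure (μ r)) (hℓ : ContinuousWithinAt ℓ I t)
    {f : E → ℝ} (hf : ContDiff ℝ ∞ f) (hfc : HasCompactSupport f)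
    (hA : ContinuousWithinAt (fun r => ∫ x, f (Real.exp (-ℓ t) • x) ∂μ r) I t) :
    ContinuousWithinAt (fun r => ∫ x, f (Real.exp (-ℓ r) • x) ∂μ r) I t := by
  obtain ⟨C, hC⟩ := hfc.radialDeriv.exists_bound_of_continuous hf.radialDeriv.continuous
  have hint : ∀ (c : ℝ) (ρ : Measure E), IsProbabilityMeasure ρ →
      Integrable (fun x => f (Real.exp c • x)) ρ := by
    intro c ρ _
    exact (hfc.comp_pos_smul (Real.exp_pos c)).integrable_of_contDiff
      (hf.comp (contDiff_const_smul _)) ρ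
  have h0 : Tendsto (fun r => (∫ x, f (Real.exp (-ℓ r) • x) ∂μ r)
      - ∫ x, f (Real.exp (-ℓ t) • x) ∂μ r) (𝓝[I] t) (𝓝 0) := by
    refine squeeze_zero_norm' (a := fun r => C * |ℓ r - ℓ t|) ?_ ?_
    · filter_upwards [self_mem_nhdsWithin] with r hr
      have := hμ r hr
      rw [← integral_sub (hint _ _ this) (hint _ _ this)]
      refine (norm_integral_le_of_norm_le_const (μ := μ r) (ae_of_all _ fun x => ?_)).trans_eq
        (by rw [probReal_univ, mul_one])
      exact abs_comp_exp_neg_smul_sub_le (hf.differentiable (by simp)) hC x (ℓ t) (ℓ r)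
    · have : Tendsto (fun r => C * |ℓ r - ℓ t|) (𝓝[I] t) (𝓝 (C * |ℓ t - ℓ t|)) :=
        ((hℓ.tendsto.sub_const _).abs).const_mul C
      simpa using this
  have h1 := h0.add hA.tendsto
  simp only [sub_add_cancel, zero_add] at h1
  exact h1

end TestFunctions

/-! ### Laplacians of plane waves with a cutoff. -/

section LaplacianOfCutoffs

open Filter Topology

variable {E : Type*} [NormedAddCommGroup E] [InnerProductSpace ℝ E]

theorem ContDiff.fderiv_apply_const {f : E → ℝ} (hf : ContDiff ℝ ∞ f) (v : E) :
    ContDiff ℝ ∞ fun y => fderiv ℝ f y v :=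
  (hf.fderiv_right (m := ∞) (by simp)).clm_apply contDiff_const

theorem HasCompactSupport.fderiv_apply_const {f : E → ℝ} (hf : HasCompactSupport f) (v : E) :
    HasCompactSupport fun y => fderiv ℝ f y v :=
  (hf.fderiv ℝ).mono fun x hx h => hx (by simp [h])

theorem fderiv_fderiv_apply_mul {f g : E → ℝ} (hf : ContDiff ℝ ∞ f) (hg : ContDiff ℝ ∞ g)
    (x v : E) :
    fderiv ℝ (fun y => fderiv ℝ (fun z => f z * g z) y v) x v =
      f x * fderiv ℝ (fun y => fderiv ℝ g y v) x v
        + 2 * (fderiv ℝ f x v * fderiv ℝ g x v)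
        + g x * fderiv ℝ (fun y => fderiv ℝ f y v) x v := by
  have hd : ∀ {h : E → ℝ}, ContDiff ℝ ∞ h → Differentiable ℝ h := fun h =>
    h.differentiable (by simp)
  have e : (fun y => fderiv ℝ (fun z => f z * g z) y v) =
      fun y => f y * fderiv ℝ g y v + g y * fderiv ℝ f y v := by
    ext y
    rw [fderiv_fun_mul (hd hf y) (hd hg y)]
    simp
  have h1 := hd (hf.fderiv_apply_const v)
  have h2 := hd (hg.fderiv_apply_const v)
  rw [e, fderiv_fun_add ((hd hf x).fun_mul (h2 x)) ((hd hg x).fun_mul (h1 x)),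
    fderiv_fun_mul (hd hf x) (h2 x), fderiv_fun_mul (hd hg x) (h1 x)]
  simp
  ring

theorem fderiv_comp_const_smul_apply {f : E → ℝ} (c : ℝ) (hf : Differentiable ℝ f) (x v : E) :
    fderiv ℝ (fun y => f (c • y)) x v = c * fderiv ℝ f (c • x) v := by
  have h1 : HasFDerivAt (fun y : E => c • y) (c • ContinuousLinearMap.id ℝ E) x :=
    (hasFDerivAt_id x).const_smul c
  have h2 : HasFDerivAt (fun y => f (c • y)) _ x := (hf (c • x)).hasFDerivAt.comp x h1
  rw [h2.fderiv]
  simp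

theorem fderiv_fderiv_apply_comp_const_smul {f : E → ℝ} (c : ℝ) (hf : ContDiff ℝ ∞ f) (x v : E) :
    fderiv ℝ (fun y => fderiv ℝ (fun z => f (c • z)) y v) x v =
      c ^ 2 * fderiv ℝ (fun y => fderiv ℝ f y v) (c • x) v := by
  have hd : ∀ {h : E → ℝ}, ContDiff ℝ ∞ h → Differentiable ℝ h := fun h =>
    h.differentiable (by simp)
  simp_rw [fderiv_comp_const_smul_apply c (hd hf)]
  have h2 := hd (hf.fderiv_apply_const v)
  have h3 : DifferentiableAt ℝ (fun y => fderiv ℝ f (c • y) v) x :=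
    (h2.comp (differentiable_id.const_smul c)) x
  rw [fderiv_const_mul h3]
  simp [fderiv_comp_const_smul_apply c h2]
  ring

variable (ξ : E) (θ : ℝ)

/-- The plane wave `cos(⟨ξ, y⟩ - θ)`. -/
noncomputable def planeWave (y : E) : ℝ := Real.cos (inner ℝ ξ y - θ)

theorem contDiff_planeWave : ContDiff ℝ ∞ (planeWave ξ θ) :=
  Real.contDiff_cos.comp ((contDiff_const.inner ℝ contDiff_id).sub contDiff_const)

theorem abs_planeWave_le (y : E) : |planeWave ξ θ y| ≤ 1 := Real.abs_cos_le_one _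

/-- The phase absorbs differentiation. The phases `0` and `π / 2` together give a full character. -/
theorem fderiv_planeWave_apply (y v : E) :
    fderiv ℝ (planeWave ξ θ) y v = inner ℝ ξ v * planeWave ξ (θ - Real.pi / 2) y := by
  have h1 : HasFDerivAt (fun y => inner ℝ ξ y - θ) (innerSL ℝ ξ) y :=
    (innerSL ℝ ξ).hasFDerivAt.sub_const θ
  have h2 := h1.cos
  have h3 : Real.cos (inner ℝ ξ y - (θ - Real.pi / 2)) = -Real.sin (inner ℝ ξ y - θ) := by
    rw [← Real.cos_add_pi_div_two]; ring_nf
  unfold planeWave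
  rw [h2.fderiv, h3]
  simp
  ring

theorem fderiv_fderiv_planeWave_apply (y v : E) :
    fderiv ℝ (fun y => fderiv ℝ (planeWave ξ θ) y v) y v =
      -inner ℝ ξ v ^ 2 * planeWave ξ θ y := by
  simp_rw [fderiv_planeWave_apply]
  rw [fderiv_const_mul ((contDiff_planeWave ξ _).differentiable (by simp) y)]
  have h3 : planeWave ξ (θ - Real.pi / 2 - Real.pi / 2) y = -planeWave ξ θ y := by
    unfold planeWave
    rw [← Real.cos_add_pi]; ring_nf
  simp [fderiv_planeWave_apply, h3]
  ring

variable [FiniteDimensional ℝ E]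

theorem laplacian_eq_sum_fderiv_fderiv {f : E → ℝ} (hf : ContDiff ℝ ∞ f) (x : E) :
    Δ f x = ∑ i, fderiv ℝ (fun y => fderiv ℝ f y (stdOrthonormalBasis ℝ E i)) x
      (stdOrthonormalBasis ℝ E i) := by
  rw [InnerProductSpace.laplacian_eq_iteratedFDeriv_stdOrthonormalBasis]
  refine Finset.sum_congr rfl fun i _ => ?_
  rw [iteratedFDeriv_two_apply]
  have h : Differentiable ℝ (fderiv ℝ f) :=
    (hf.fderiv_right (m := ∞) (by simp)).differentiable (by simp)
  rw [fderiv_clm_apply (h x) (differentiableAt_const _)]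
  simp

theorem laplacian_comp_const_smul {f : E → ℝ} (c : ℝ) (hf : ContDiff ℝ ∞ f) (x : E) :
    Δ (fun y => f (c • y)) x = c ^ 2 * Δ f (c • x) := by
  have h : ContDiff ℝ ∞ fun y => f (c • y) := hf.comp (contDiff_const_smul c)
  rw [laplacian_eq_sum_fderiv_fderiv h,
    laplacian_eq_sum_fderiv_fderiv hf, Finset.mul_sum]
  exact Finset.sum_congr rfl fun i _ => fderiv_fderiv_apply_comp_const_smul c hf x _

theorem ContDiff.laplacian {f : E → ℝ} (hf : ContDiff ℝ ∞ f) : ContDiff ℝ ∞ (Δ f) := by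
  rw [funext (laplacian_eq_sum_fderiv_fderiv hf)]
  exact ContDiff.sum fun i _ => (hf.fderiv_apply_const _).fderiv_apply_const _

theorem HasCompactSupport.laplacian {f : E → ℝ} (hfc : HasCompactSupport f) :
    HasCompactSupport (Δ f) := by
  refine ((hfc.fderiv ℝ).fderiv ℝ).mono fun x hx h => hx ?_
  rw [InnerProductSpace.laplacian_eq_iteratedFDeriv_stdOrthonormalBasis]
  simp [iteratedFDeriv_two_apply, h]

/-- A plane wave, cut off at distance of order `1 / ε`. -/
noncomputable def cutoffWave (ε : ℝ) (y : E) : ℝ :=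
  planeWave ξ θ y * (⟨1, 2, one_pos, one_lt_two⟩ : ContDiffBump (0 : E)) (ε • y)

theorem contDiff_cutoffWave (ε : ℝ) : ContDiff ℝ ∞ (cutoffWave ξ θ ε) :=
  (contDiff_planeWave ξ θ).mul ((ContDiffBump.contDiff _).comp (contDiff_const_smul ε))

theorem hasCompactSupport_cutoffWave {ε : ℝ} (hε : 0 < ε) :
    HasCompactSupport (cutoffWave ξ θ ε) :=
  ((ContDiffBump.hasCompactSupport _).comp_pos_smul hε).mul_left

theorem abs_cutoffWave_le (ε : ℝ) (y : E) : |cutoffWave ξ θ ε y| ≤ 1 := by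
  rw [cutoffWave, abs_mul, abs_of_nonneg (ContDiffBump.nonneg _)]
  exact mul_le_one₀ (abs_planeWave_le ξ θ y) (ContDiffBump.nonneg _) (ContDiffBump.le_one _)

theorem tendsto_cutoffWave (y : E) :
    Tendsto (fun ε => cutoffWave ξ θ ε y) (𝓝 0) (𝓝 (planeWave ξ θ y)) := by
  set χ : ContDiffBump (0 : E) := ⟨1, 2, one_pos, one_lt_two⟩
  have h : Continuous fun ε : ℝ => planeWave ξ θ y * χ (ε • y) :=
    continuous_const.mul (χ.continuous.comp (continuous_id.smul continuous_const))
  have h0 := h.tendsto 0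
  rw [zero_smul, χ.one_of_mem_closedBall (by simp [χ]), mul_one] at h0
  exact h0

/-- A plane wave is an eigenfunction of the Laplacian with eigenvalue `-‖ξ‖ ^ 2`. Each derivative
that falls on the cutoff instead costs a factor `ε`, and `ε ^ 2 ≤ ε`. -/
theorem exists_abs_laplacian_cutoffWave_add_le :
    ∃ C, 0 ≤ C ∧ ∀ ε, 0 < ε → ε ≤ 1 → ∀ y,
      |Δ (cutoffWave ξ θ ε) y + ‖ξ‖ ^ 2 * cutoffWave ξ θ ε y| ≤ C * ε := by
  set χ : ContDiffBump (0 : E) := ⟨1, 2, one_pos, one_lt_two⟩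
  have hχ : ContDiff ℝ ∞ χ := χ.contDiff
  have hχc : HasCompactSupport χ := χ.hasCompactSupport
  set e := stdOrthonormalBasis ℝ E
  choose M₁ hM₁ using fun i => (hχc.fderiv_apply_const (e i)).exists_bound_of_continuous
    (hχ.fderiv_apply_const (e i)).continuous
  choose M₂ hM₂ using fun i =>
    ((hχc.fderiv_apply_const (e i)).fderiv_apply_const (e i)).exists_bound_of_continuous
      ((hχ.fderiv_apply_const (e i)).fderiv_apply_const (e i)).continuous
  have hM₁0 : ∀ i, 0 ≤ M₁ i := fun i => (norm_nonneg _).trans (hM₁ i 0)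
  have hM₂0 : ∀ i, 0 ≤ M₂ i := fun i => (norm_nonneg _).trans (hM₂ i 0)
  refine ⟨∑ i, (M₂ i + 2 * (|inner ℝ ξ (e i)| * M₁ i)), Finset.sum_nonneg fun i _ => by
    have := hM₁0 i; have := hM₂0 i; positivity, fun ε hε hε1 y => ?_⟩
  have hexp : Δ (cutoffWave ξ θ ε) y + ‖ξ‖ ^ 2 * cutoffWave ξ θ ε y = ∑ i,
      (planeWave ξ θ y * (ε ^ 2 * fderiv ℝ (fun y => fderiv ℝ χ y (e i)) (ε • y) (e i))
        + 2 * (inner ℝ ξ (e i) * planeWave ξ (θ - Real.pi / 2) y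
          * (ε * fderiv ℝ χ (ε • y) (e i)))) := by
    rw [laplacian_eq_sum_fderiv_fderiv (contDiff_cutoffWave ξ θ ε), ← e.sum_sq_inner_left ξ,
      Finset.sum_mul, ← Finset.sum_add_distrib]
    refine Finset.sum_congr rfl fun i _ => ?_
    have := fderiv_fderiv_apply_mul (contDiff_planeWave ξ θ)
      (hχ.comp (contDiff_const_smul ε)) y (e i)
    simp only [Function.comp_def] at this
    unfold cutoffWave
    rw [this, fderiv_fderiv_apply_comp_const_smul ε hχ,
      fderiv_comp_const_smul_apply ε (hχ.differentiable (by simp)), fderiv_planeWave_apply,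
      fderiv_fderiv_planeWave_apply]
    ring
  rw [hexp, Finset.sum_mul]
  refine (Finset.abs_sum_le_sum_abs _ _).trans (Finset.sum_le_sum fun i _ => ?_)
  refine (abs_add_le _ _).trans ?_
  rw [add_mul]
  have hp := abs_planeWave_le ξ θ y
  have hp' := abs_planeWave_le ξ (θ - Real.pi / 2) y
  have h1 := hM₁ i (ε • y)
  have h2 := hM₂ i (ε • y)
  rw [Real.norm_eq_abs] at h1 h2
  refine add_le_add ?_ ?_
  · rw [abs_mul, abs_mul, abs_of_nonneg (sq_nonneg ε)]
    calc _ ≤ 1 * (ε * 1 * M₂ i) := by rw [sq]; gcongr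
      _ = _ := by ring
  · rw [abs_mul, abs_mul, abs_mul, abs_mul, abs_two, abs_of_pos hε]
    calc _ ≤ 2 * (|inner ℝ ξ (e i)| * 1 * (ε * M₁ i)) := by gcongr
      _ = _ := by ring

end LaplacianOfCutoffs

/-! ### Elementary properties of the interval and of the noise schedule. -/

section NoiseSchedule

variable {I : Set ℝ} {s σ : ℝ → ℝ}

theorem Convex.Icc_zero_subset (hI : Convex ℝ I) (hI_zero : 0 ∈ I) {t : ℝ} (ht : t ∈ I) :
    Icc 0 t ⊆ I :=
  hI.ordConnected.out hI_zero ht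

theorem Convex.Ioo_zero_subset_interior (hI : Convex ℝ I) (hI_zero : 0 ∈ I) {t : ℝ} (ht : t ∈ I) :
    Ioo 0 t ⊆ interior I :=
  interior_maximal (Ioo_subset_Icc_self.trans (hI.Icc_zero_subset hI_zero ht)) isOpen_Ioo

theorem pos_of_mem_interior (hI_nonneg : ∀ t ∈ I, 0 ≤ t) {t : ℝ} (ht : t ∈ interior I) : 0 < t := by
  have h : interior I ⊆ interior (Ici 0) := interior_mono fun t ht => hI_nonneg t ht
  rw [interior_Ici] at h
  exact h ht

namespace IsNoiseSchedule

theorem hasDerivAt_s (h : IsNoiseSchedule I s σ) {t : ℝ} (ht : t ∈ interior I) :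
    HasDerivAt s (deriv s t) t :=
  ((h.s_contDiffOn.differentiableOn (by simp)).differentiableAt
    (isOpen_interior.mem_nhds ht)).hasDerivAt

theorem hasDerivAt_σ (h : IsNoiseSchedule I s σ) {t : ℝ} (ht : t ∈ interior I) :
    HasDerivAt σ (deriv σ t) t :=
  ((h.σ_contDiffOn.differentiableOn (by simp)).differentiableAt
    (isOpen_interior.mem_nhds ht)).hasDerivAt

theorem σ_nonneg (h : IsNoiseSchedule I s σ) (hI_zero : 0 ∈ I) (hI_nonneg : ∀ t ∈ I, 0 ≤ t)
    {t : ℝ} (ht : t ∈ I) : 0 ≤ σ t := by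
  rw [← h.σ_zero]
  exact h.σ_strictMonoOn.monotoneOn hI_zero ht (hI_nonneg t ht)

theorem σ_pos (h : IsNoiseSchedule I s σ) (hI_zero : 0 ∈ I) {t : ℝ} (ht : t ∈ I) (ht0 : 0 < t) :
    0 < σ t := by
  rw [← h.σ_zero]
  exact h.σ_strictMonoOn hI_zero ht ht0

theorem deriv_σ_nonneg (h : IsNoiseSchedule I s σ) {t : ℝ} (ht : t ∈ interior I) :
    0 ≤ deriv σ t := by
  rw [← derivWithin_of_mem_nhds (mem_interior_iff_mem_nhds.1 ht)]
  exact h.σ_strictMonoOn.monotoneOn.derivWithin_nonneg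

theorem edmVolatility_sq (h : IsNoiseSchedule I s σ) (hI_zero : 0 ∈ I)
    (hI_nonneg : ∀ t ∈ I, 0 ≤ t) {t : ℝ} (ht : t ∈ interior I) :
    edmVolatility s σ t ^ 2 / 2 = s t ^ 2 * (deriv σ t * σ t) := by
  have h1 := h.deriv_σ_nonneg ht
  have h2 := h.σ_nonneg hI_zero hI_nonneg (interior_subset ht)
  rw [edmVolatility, mul_pow, Real.sq_sqrt (by positivity)]
  ring

end IsNoiseSchedule

end NoiseSchedule

/-- Both `B - F` and `B + F` are nondecreasing. Comparison with `B` replaces a constant bound on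
`F'`, since `deriv σ` may be unbounded near the endpoints. -/
theorem abs_sub_le_sub_of_abs_deriv_le {F B F' B' : ℝ → ℝ} {a b : ℝ} (hab : a ≤ b)
    (hF : ContinuousOn F (Icc a b)) (hB : ContinuousOn B (Icc a b))
    (hF' : ∀ t ∈ Ioo a b, HasDerivAt F (F' t) t) (hB' : ∀ t ∈ Ioo a b, HasDerivAt B (B' t) t)
    (hle : ∀ t ∈ Ioo a b, |F' t| ≤ B' t) : |F b - F a| ≤ B b - B a := by
  have h1 : MonotoneOn (B - F) (Icc a b) := by
    refine monotoneOn_of_hasDerivWithinAt_nonneg (convex_Icc a b) (hB.sub hF) (f' := B' - F')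
      (fun t ht => ?_) fun t ht => ?_
    all_goals rw [interior_Icc] at ht
    · exact ((hB' t ht).sub (hF' t ht)).hasDerivWithinAt
    · exact sub_nonneg.2 ((le_abs_self _).trans (hle t ht))
  have h2 : MonotoneOn (B + F) (Icc a b) := by
    refine monotoneOn_of_hasDerivWithinAt_nonneg (convex_Icc a b) (hB.add hF) (f' := B' + F')
      (fun t ht => ?_) fun t ht => ?_
    all_goals rw [interior_Icc] at ht
    · exact ((hB' t ht).add (hF' t ht)).hasDerivWithinAt
    · have := (neg_abs_le _).trans' (neg_le_neg (hle t ht))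
      simp only [Pi.add_apply]
      linarith
  have h1' := h1 (left_mem_Icc.2 hab) (right_mem_Icc.2 hab) hab
  have h2' := h2 (left_mem_Icc.2 hab) (right_mem_Icc.2 hab) hab
  simp only [Pi.sub_apply, Pi.add_apply] at h1' h2'
  rw [abs_le]
  constructor <;> linarith

/-! ### Uniqueness for the Fokker-Planck equation: the forward kernel is Gaussian. -/

section ForwardKernel

open Filter Topology

variable {d : ℕ} {I : Set ℝ} {s σ : ℝ → ℝ}
  {K : ℝ → Kernel (EuclideanSpace ℝ (Fin d)) (EuclideanSpace ℝ (Fin d))}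

namespace IsForwardKernel

theorem continuousOn_integral_rescaled (hsσ : IsNoiseSchedule I s σ)
    (hK : IsForwardKernel I (edmDrift s) (edmVolatility s σ) K) (x₀ : EuclideanSpace ℝ (Fin d))
    {f : EuclideanSpace ℝ (Fin d) → ℝ} (hf : ContDiff ℝ ∞ f) (hfc : HasCompactSupport f) :
    ContinuousOn (fun t => ∫ x, f ((s t)⁻¹ • x) ∂K t x₀) I := by
  have hcont : ContinuousOn (fun t => ∫ x, f (Real.exp (-Real.log (s t)) • x) ∂K t x₀) I :=
    fun t ht => continuousWithinAt_integral_comp_exp_neg_smul (μ := fun t => K t x₀)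
      (fun r hr => have := hK.markov r hr; inferInstance)
      ((hsσ.s_continuousOn t ht).log (hsσ.s_pos t ht).ne') hf hfc
      (hK.continuousOn x₀ _ (hf.comp (contDiff_const_smul _))
        (hfc.comp_pos_smul (Real.exp_pos _)) t ht)
  refine hcont.congr fun t ht => ?_
  simp only [Real.exp_neg, Real.exp_log (hsσ.s_pos t ht)]

/-- The drift term cancels against the motion of the test function `f (x / s t)`; in the diffusion
term, the factor `s t ^ 2` cancels against the scaling of the Laplacian. -/
theorem hasDerivAt_integral_rescaled (hI_zero : 0 ∈ I) (hI_nonneg : ∀ t ∈ I, 0 ≤ t)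
    (hsσ : IsNoiseSchedule I s σ)
    (hK : IsForwardKernel I (edmDrift s) (edmVolatility s σ) K) (x₀ : EuclideanSpace ℝ (Fin d))
    {f : EuclideanSpace ℝ (Fin d) → ℝ} (hf : ContDiff ℝ ∞ f) (hfc : HasCompactSupport f)
    {t : ℝ} (ht : t ∈ interior I) :
    HasDerivAt (fun t => ∫ x, f ((s t)⁻¹ • x) ∂K t x₀)
      (deriv σ t * σ t * ∫ x, Δ f ((s t)⁻¹ • x) ∂K t x₀) t := by
  have hs0 := hsσ.s_pos t (interior_subset ht)
  have hexp : ∀ r ∈ I, Real.exp (-Real.log (s r)) = (s r)⁻¹ := fun r hr => by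
    rw [Real.exp_neg, Real.exp_log (hsσ.s_pos r hr)]
  have hI_nhds : ∀ᶠ r in 𝓝 t, r ∈ I := mem_interior_iff_mem_nhds.1 ht
  have := hK.markov t (interior_subset ht)
  have key := hasDerivAt_integral_comp_exp_neg_smul (μ := fun t => K t x₀)
    (hI_nhds.mono fun r hr => have := hK.markov r hr; inferInstance)
    ((hsσ.hasDerivAt_s ht).log hs0.ne') hf hfc
    (hK.fokkerPlanck x₀ _ (hf.comp (contDiff_const_smul _))
      (hfc.comp_pos_smul (Real.exp_pos _)) t ht)
    (hK.fokkerPlanck x₀ _ (hf.radialDeriv.comp (contDiff_const_smul _))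
      (hfc.radialDeriv.comp_pos_smul (Real.exp_pos _)) t ht).differentiableAt
  simp only [hexp t (interior_subset ht)] at key
  refine (key.congr_of_eventuallyEq (hI_nhds.mono fun r hr => ?_)).congr_deriv ?_
  · simp only [hexp r hr]
  have hgen : ∀ x, sdeGenerator (edmDrift s) (edmVolatility s σ) t (fun x => f ((s t)⁻¹ • x)) x =
      deriv s t / s t * radialDeriv f ((s t)⁻¹ • x)
        + deriv σ t * σ t * Δ f ((s t)⁻¹ • x) := by
    intro x
    rw [sdeGenerator, hsσ.edmVolatility_sq hI_zero hI_nonneg ht, edmDrift,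
      fderiv_comp_const_smul_apply _ (hf.differentiable (by simp)),
      laplacian_comp_const_smul _ hf, radialDeriv]
    simp only [map_smul, smul_eq_mul]
    field_simp
  have e : (fun x => f ((s t)⁻¹ • x)) = f ∘ fun x => (s t)⁻¹ • x := rfl
  have hi1 : Integrable (fun x => radialDeriv f ((s t)⁻¹ • x)) (K t x₀) :=
    (hfc.radialDeriv.comp_pos_smul (inv_pos.2 hs0)).integrable_of_contDiff
      (hf.radialDeriv.comp (contDiff_const_smul _)) _
  have hi2 : Integrable (fun x => Δ f ((s t)⁻¹ • x)) (K t x₀) :=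
    (hfc.laplacian.comp_pos_smul (inv_pos.2 hs0)).integrable_of_contDiff
      (hf.laplacian.comp (contDiff_const_smul _)) _
  rw [← e]
  simp_rw [hgen]
  rw [integral_add (hi1.const_mul _) (hi2.const_mul _), integral_const_mul, integral_const_mul]
  ring

/-- The exponential is the integrating factor that would make the integral of the plane wave
constant in time; the cutoff spoils this by `O(ε)`. -/
theorem abs_integral_cutoffWave_sub_le (hI : Convex ℝ I) (hI_zero : 0 ∈ I)
    (hI_nonneg : ∀ t ∈ I, 0 ≤ t) (hsσ : IsNoiseSchedule I s σ)
    (hK : IsForwardKernel I (edmDrift s) (edmVolatility s σ) K) (x₀ ξ : EuclideanSpace ℝ (Fin d))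
    (θ : ℝ) {t : ℝ} (ht : t ∈ I) :
    ∃ C, ∀ ε, 0 < ε → ε ≤ 1 →
      |Real.exp (‖ξ‖ ^ 2 / 2 * σ t ^ 2) * ∫ x, cutoffWave ξ θ ε ((s t)⁻¹ • x) ∂K t x₀
        - cutoffWave ξ θ ε x₀| ≤ C * ε := by
  obtain ⟨C, hC0, hC⟩ := exists_abs_laplacian_cutoffWave_add_le ξ θ
  set A := Real.exp (‖ξ‖ ^ 2 / 2 * σ t ^ 2)
  -- `A` bounds the integrating factor on `[0, t]`, and `σ t ^ 2 / 2` is the increment of the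
  -- primitive of `σ * deriv σ`.
  refine ⟨A * C * (σ t ^ 2 / 2), fun ε hε hε1 => ?_⟩
  have hf := contDiff_cutoffWave ξ θ ε
  have hfc := hasCompactSupport_cutoffWave ξ θ hε
  have hsub := hI.Icc_zero_subset hI_zero ht
  have hsub' := hI.Ioo_zero_subset_interior hI_zero ht
  have hσc := hsσ.σ_continuousOn.mono hsub
  set h := fun r => ∫ x, cutoffWave ξ θ ε ((s r)⁻¹ • x) ∂K r x₀
  set L := fun r => ∫ x, Δ (cutoffWave ξ θ ε) ((s r)⁻¹ • x) ∂K r x₀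
  have key := abs_sub_le_sub_of_abs_deriv_le (hI_nonneg t ht)
    (F := fun r => Real.exp (‖ξ‖ ^ 2 / 2 * σ r ^ 2) * h r)
    (B := fun r => A * C * ε * (σ r ^ 2 / 2))
    (F' := fun r => Real.exp (‖ξ‖ ^ 2 / 2 * σ r ^ 2) * (‖ξ‖ ^ 2 / 2 * (2 * σ r * deriv σ r)) * h r
      + Real.exp (‖ξ‖ ^ 2 / 2 * σ r ^ 2) * (deriv σ r * σ r * L r))
    (B' := fun r => A * C * ε * (σ r * deriv σ r))
    (((continuousOn_const.mul (hσc.pow 2)).rexp).mul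
      ((hK.continuousOn_integral_rescaled hsσ x₀ hf hfc).mono hsub))
    (continuousOn_const.mul ((hσc.pow 2).div_const 2))
    (fun r hr => ?_) (fun r hr => ?_) (fun r hr => ?_)
  · have h0 : h 0 = cutoffWave ξ θ ε x₀ := by
      simp [h, hsσ.s_zero, hK.initial]
    simp only [hsσ.σ_zero, h0] at key
    refine (le_of_eq_of_le ?_ key).trans_eq (by ring)
    rw [zero_pow two_ne_zero, mul_zero, Real.exp_zero, one_mul]
  · have h1 := (((hsσ.hasDerivAt_σ (hsub' hr)).pow 2).const_mul (‖ξ‖ ^ 2 / 2)).exp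
    have h2 := h1.mul (hK.hasDerivAt_integral_rescaled hI_zero hI_nonneg hsσ x₀ hf hfc (hsub' hr))
    refine h2.congr_deriv ?_
    simp [L, h]
  · have h1 := (((hsσ.hasDerivAt_σ (hsub' hr)).pow 2).div_const 2).const_mul (A * C * ε)
    refine h1.congr_deriv ?_
    push_cast
    ring
  · have hrI := interior_subset (hsub' hr)
    have := hK.markov r hrI
    have hs0 := hsσ.s_pos r hrI
    have hσ0 := hsσ.σ_nonneg hI_zero hI_nonneg hrI
    have hσ'0 := hsσ.deriv_σ_nonneg (hsub' hr)
    have hi1 : Integrable (fun x => cutoffWave ξ θ ε ((s r)⁻¹ • x)) (K r x₀) :=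
      (hfc.comp_pos_smul (inv_pos.2 hs0)).integrable_of_contDiff
        (hf.comp (contDiff_const_smul _)) _
    have hi2 : Integrable (fun x => Δ (cutoffWave ξ θ ε) ((s r)⁻¹ • x)) (K r x₀) :=
      (hfc.laplacian.comp_pos_smul (inv_pos.2 hs0)).integrable_of_contDiff
        (hf.laplacian.comp (contDiff_const_smul _)) _
    have hbound : |L r + ‖ξ‖ ^ 2 * h r| ≤ C * ε := by
      rw [← integral_const_mul, ← integral_add hi2 (hi1.const_mul _), ← Real.norm_eq_abs]
      refine (norm_integral_le_of_norm_le_const (μ := K r x₀) (ae_of_all _ fun x => ?_)).trans_eq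
        (by rw [probReal_univ, mul_one])
      exact hC ε hε hε1 _
    have hA : Real.exp (‖ξ‖ ^ 2 / 2 * σ r ^ 2) ≤ A := by
      have : σ r ≤ σ t := hsσ.σ_strictMonoOn.monotoneOn hrI ht hr.2.le
      exact Real.exp_le_exp.2 (by gcongr)
    calc _ = |Real.exp (‖ξ‖ ^ 2 / 2 * σ r ^ 2) * (L r + ‖ξ‖ ^ 2 * h r) * (σ r * deriv σ r)| := by
          congr 1; ring
      _ = Real.exp (‖ξ‖ ^ 2 / 2 * σ r ^ 2) * |L r + ‖ξ‖ ^ 2 * h r| * (σ r * deriv σ r) := by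
          rw [abs_mul, abs_mul, Real.abs_exp, abs_of_nonneg (mul_nonneg hσ0 hσ'0)]
      _ ≤ A * (C * ε) * (σ r * deriv σ r) := by gcongr
      _ = _ := by ring

theorem integral_planeWave (hI : Convex ℝ I) (hI_zero : 0 ∈ I)
    (hI_nonneg : ∀ t ∈ I, 0 ≤ t) (hsσ : IsNoiseSchedule I s σ)
    (hK : IsForwardKernel I (edmDrift s) (edmVolatility s σ) K) (x₀ ξ : EuclideanSpace ℝ (Fin d))
    (θ : ℝ) {t : ℝ} (ht : t ∈ I) :
    ∫ x, planeWave ξ θ ((s t)⁻¹ • x) ∂K t x₀ =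
      Real.exp (-(‖ξ‖ ^ 2 / 2 * σ t ^ 2)) * planeWave ξ θ x₀ := by
  obtain ⟨C, hC⟩ := hK.abs_integral_cutoffWave_sub_le hI hI_zero hI_nonneg hsσ x₀ ξ θ ht
  have := hK.markov t ht
  have hlim1 : Tendsto (fun ε => ∫ x, cutoffWave ξ θ ε ((s t)⁻¹ • x) ∂K t x₀) (𝓝[>] 0)
      (𝓝 (∫ x, planeWave ξ θ ((s t)⁻¹ • x) ∂K t x₀)) := by
    refine tendsto_integral_filter_of_dominated_convergence (fun _ => 1)
      (Eventually.of_forall fun ε => ?_) (Eventually.of_forall fun ε => ?_)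
      (integrable_const _) (ae_of_all _ fun x => ?_)
    · exact ((contDiff_cutoffWave ξ θ ε).continuous.comp
        (continuous_const_smul _)).aestronglyMeasurable
    · exact ae_of_all _ fun x => abs_cutoffWave_le ξ θ ε _
    · exact (tendsto_cutoffWave ξ θ _).mono_left nhdsWithin_le_nhds
  have hlim2 := ((hlim1.const_mul (Real.exp (‖ξ‖ ^ 2 / 2 * σ t ^ 2))).sub
    ((tendsto_cutoffWave ξ θ x₀).mono_left nhdsWithin_le_nhds)).abs
  have hlim3 : Tendsto (fun ε : ℝ => C * ε) (𝓝[>] 0) (𝓝 0) := by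
    have : Tendsto (fun ε : ℝ => C * ε) (𝓝 0) (𝓝 (C * 0)) := tendsto_id.const_mul C
    rw [mul_zero] at this
    exact this.mono_left nhdsWithin_le_nhds
  have hle := le_of_tendsto_of_tendsto hlim2 hlim3 (by
    filter_upwards [Ioc_mem_nhdsGT one_pos] with ε hε using hC ε hε.1 hε.2)
  have h0 := abs_nonpos_iff.1 hle
  rw [Real.exp_neg, ← sub_eq_zero.1 h0, inv_mul_cancel_left₀ (Real.exp_ne_zero _)]

/-- A forward kernel of the equation is Gaussian: the Fokker-Planck equation started from a point
mass has only one solution. -/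
theorem apply_eq_map (hI : Convex ℝ I) (hI_zero : 0 ∈ I)
    (hI_nonneg : ∀ t ∈ I, 0 ≤ t) (hsσ : IsNoiseSchedule I s σ)
    (hK : IsForwardKernel I (edmDrift s) (edmVolatility s σ) K) {t : ℝ} (ht : t ∈ I)
    (x₀ : EuclideanSpace ℝ (Fin d)) :
    K t x₀ = (stdGaussian (EuclideanSpace ℝ (Fin d))).map fun z => s t • (x₀ + σ t • z) := by
  have := hK.markov t ht
  have hs0 := hsσ.s_pos t ht
  have : IsProbabilityMeasure
      ((stdGaussian (EuclideanSpace ℝ (Fin d))).map fun z => s t • (x₀ + σ t • z)) :=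
    Measure.isProbabilityMeasure_map (by fun_prop)
  refine Measure.ext_of_charFun (funext fun η => ?_)
  have hR : charFun ((stdGaussian (EuclideanSpace ℝ (Fin d))).map
      fun z => s t • (x₀ + σ t • z)) η =
      Complex.exp (-(‖s t • η‖ ^ 2 / 2 * σ t ^ 2 : ℝ)) *
        Complex.exp ((inner ℝ (s t • η) x₀ : ℝ) * Complex.I) := by
    rw [charFun_map_smul_comp (f := fun z => x₀ + σ t • z) (by fun_prop)]
    have e : (stdGaussian (EuclideanSpace ℝ (Fin d))).map (fun z => x₀ + σ t • z) =
        ((stdGaussian (EuclideanSpace ℝ (Fin d))).map fun z => σ t • z).map fun y => x₀ + y := by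
      rw [Measure.map_map (by fun_prop) (by fun_prop)]; rfl
    rw [e, charFun_map_const_add, charFun_map_smul, charFun_stdGaussian, real_inner_comm]
    congr 2
    rw [norm_smul (σ t), Real.norm_of_nonneg (hsσ.σ_nonneg hI_zero hI_nonneg ht)]
    push_cast
    ring
  -- The frequency is `s t • η` because the waves are evaluated at `x / s t`.
  have hwave : ∀ x, Complex.exp ((inner ℝ x η : ℝ) * Complex.I) =
      ((planeWave (s t • η) 0 ((s t)⁻¹ • x) : ℝ) : ℂ)
        + ((planeWave (s t • η) (Real.pi / 2) ((s t)⁻¹ • x) : ℝ) : ℂ) * Complex.I := by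
    intro x
    have e : inner ℝ (s t • η) ((s t)⁻¹ • x) = inner ℝ x η := by
      rw [real_inner_smul_left, real_inner_smul_right, mul_inv_cancel_left₀ hs0.ne',
        real_inner_comm]
    rw [planeWave, planeWave, e, sub_zero, Real.cos_sub_pi_div_two, Complex.exp_mul_I]
    simp
  have hint : ∀ θ, Integrable (fun x => planeWave (s t • η) θ ((s t)⁻¹ • x)) (K t x₀) := fun θ =>
    Integrable.of_bound (((contDiff_planeWave (s t • η) θ).continuous.comp
      (continuous_const_smul _)).aestronglyMeasurable) 1
      (ae_of_all _ fun x => abs_planeWave_le _ _ _)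
  rw [hR, charFun_apply]
  simp_rw [hwave]
  rw [integral_add (hint _).ofReal ((hint _).ofReal.mul_const _), integral_mul_const,
    integral_complex_ofReal, integral_complex_ofReal,
    hK.integral_planeWave hI hI_zero hI_nonneg hsσ x₀ _ _ ht,
    hK.integral_planeWave hI hI_zero hI_nonneg hsσ x₀ _ _ ht, Complex.exp_mul_I]
  unfold planeWave
  rw [sub_zero, Real.cos_sub_pi_div_two]
  push_cast
  ring

end IsForwardKernel

end ForwardKernel

/-! ### Two convexity inequalities for exponential weights. -/

section ExponentialInequalities

variable {α : Type*} [MeasurableSpace α] {p : Measure α} [IsProbabilityMeasure p] {v : α → ℝ}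

theorem integrable_exp_neg (hv : Integrable v p) (h0 : ∀ x, 0 ≤ v x) :
    Integrable (fun x => Real.exp (-v x)) p :=
  Integrable.of_bound (hv.1.neg.aemeasurable.exp.aestronglyMeasurable) 1
    (ae_of_all _ fun x => by
      rw [Real.norm_eq_abs, Real.abs_exp]; exact Real.exp_le_one_iff.2 (neg_nonpos.2 (h0 x)))

/-- Jensen's inequality for the exponential. -/
theorem exp_neg_integral_le (hv : Integrable v p) (h0 : ∀ x, 0 ≤ v x) :
    Real.exp (-∫ x, v x ∂p) ≤ ∫ x, Real.exp (-v x) ∂p := by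
  set m := ∫ x, v x ∂p
  -- The tangent of `exp (-v)` at the mean `m` lies below the graph and has mean `exp (-m)`.
  have h1 : ∫ x, Real.exp (-m) * (1 - (v x - m)) ∂p = Real.exp (-m) := by
    have hvm : Integrable (fun x => v x - m) p := hv.sub (integrable_const _)
    rw [integral_const_mul, integral_sub (integrable_const _) hvm,
      integral_sub hv (integrable_const _)]
    simp [m]
  rw [← h1]
  refine integral_mono (((integrable_const _).sub (hv.sub (integrable_const _))).const_mul _)
    (integrable_exp_neg hv h0) fun x => ?_
  have h2 := Real.add_one_le_exp (-(v x - m))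
  calc Real.exp (-m) * (1 - (v x - m)) ≤ Real.exp (-m) * Real.exp (-(v x - m)) := by
        gcongr; linarith
    _ = Real.exp (-v x) := by rw [← Real.exp_add]; ring_nf

/-- Reweighting by `e^{-v}` decreases the mean of `v`. -/
theorem integral_mul_exp_neg_le (hv : Integrable v p) (h0 : ∀ x, 0 ≤ v x) :
    ∫ x, v x * Real.exp (-v x) ∂p ≤ (∫ x, v x ∂p) * ∫ x, Real.exp (-v x) ∂p := by
  set m := ∫ x, v x ∂p
  have hE := integrable_exp_neg hv h0
  have h1 : ∫ x, (m * Real.exp (-v x) + Real.exp (-m) * (v x - m)) ∂p =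
      m * ∫ x, Real.exp (-v x) ∂p := by
    have hvm : Integrable (fun x => v x - m) p := hv.sub (integrable_const _)
    rw [integral_add (hE.const_mul _) (hvm.const_mul _),
      integral_const_mul, integral_const_mul, integral_sub hv (integrable_const _)]
    simp [m]
  rw [← h1]
  refine integral_mono_of_nonneg (ae_of_all _ fun x => mul_nonneg (h0 x) (Real.exp_pos _).le)
    ((hE.const_mul _).add ((hv.sub (integrable_const _)).const_mul _)) (ae_of_all _ fun x => ?_)
  -- Chebyshev's association argument: `v` and `exp (-v)` vary in opposite directions.
  have h2 : (v x - m) * (Real.exp (-v x) - Real.exp (-m)) ≤ 0 := by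
    rcases le_total (v x) m with h | h
    · exact mul_nonpos_of_nonpos_of_nonneg (sub_nonpos.2 h)
        (sub_nonneg.2 (Real.exp_le_exp.2 (neg_le_neg h)))
    · exact mul_nonpos_of_nonneg_of_nonpos (sub_nonneg.2 h)
        (sub_nonpos.2 (Real.exp_le_exp.2 (neg_le_neg h)))
  change v x * Real.exp (-v x) ≤ m * Real.exp (-v x) + Real.exp (-m) * (v x - m)
  linarith

end ExponentialInequalities

/-! ### The evidence and its logarithmic derivative in the inverse noise level. -/

section Evidence

open Filter Topology

variable {E : Type*} [NormedAddCommGroup E] [InnerProductSpace ℝ E]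

/-- The noise `λ (a - b) + z` that takes the datum `b` to the observation `λ a + z`, for
`w = (a, z)`. -/
def noiseTo (lam : ℝ) (w : E × E) (b : E) : E := lam • (w.1 - b) + w.2

/-- The energy of the noise that takes the datum `b` to the observation `λ a + z`. -/
noncomputable def energy (lam : ℝ) (w : E × E) (b : E) : ℝ := ‖noiseTo lam w b‖ ^ 2 / 2

theorem energy_nonneg (lam : ℝ) (w : E × E) (b : E) : 0 ≤ energy lam w b := by
  unfold energy; positivity

theorem continuous_noiseTo : Continuous fun q : ℝ × (E × E) × E => noiseTo q.1 q.2.1 q.2.2 := by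
  unfold noiseTo; fun_prop

theorem continuous_energy : Continuous fun q : ℝ × (E × E) × E => energy q.1 q.2.1 q.2.2 :=
  ((continuous_noiseTo.norm).pow 2).div_const 2

theorem hasDerivAt_energy (lam : ℝ) (w : E × E) (b : E) :
    HasDerivAt (fun lam => energy lam w b) (inner ℝ (w.1 - b) (noiseTo lam w b)) lam := by
  have h1 : HasDerivAt (fun lam => noiseTo lam w b) (w.1 - b) lam := by
    simpa [noiseTo] using ((hasDerivAt_id lam).smul_const (w.1 - b)).add_const w.2
  refine (h1.norm_sq.div_const 2).congr_deriv ?_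
  rw [real_inner_comm]
  ring

/-- This is `x ≤ exp (x² / 2)`. It provides a dominating function independent of `lam` for
differentiating the evidence. -/
theorem norm_noiseTo_mul_exp_le (lam : ℝ) (w : E × E) (b : E) :
    ‖noiseTo lam w b‖ * Real.exp (-energy lam w b) ≤ 1 := by
  have h1 : ‖noiseTo lam w b‖ ≤ Real.exp (energy lam w b) := by
    refine le_trans ?_ (Real.add_one_le_exp _)
    unfold energy
    nlinarith [sq_nonneg (‖noiseTo lam w b‖ - 1)]
  rw [Real.exp_neg]
  exact mul_inv_le_one_of_le₀ h1 (Real.exp_pos _).le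

/-- The integrand of the numerator of `posteriorSlope`. -/
theorem abs_inner_mul_exp_le (lam : ℝ) (w : E × E) (b : E) :
    |inner ℝ (w.1 - b) (noiseTo lam w b) * Real.exp (-energy lam w b)| ≤ ‖w.1 - b‖ := by
  rw [abs_mul, Real.abs_exp]
  calc _ ≤ ‖w.1 - b‖ * ‖noiseTo lam w b‖ * Real.exp (-energy lam w b) := by
        gcongr; exact abs_real_inner_le_norm _ _
    _ ≤ ‖w.1 - b‖ * 1 := by
        rw [mul_assoc]; gcongr; exact norm_noiseTo_mul_exp_le lam w b
    _ = _ := mul_one _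

/-- Writing `a - b` as `lam⁻¹` times a difference of noises bounds the slope by the energy, whose
posterior mean does not exceed its prior mean. -/
theorem abs_inner_noiseTo_le {lam : ℝ} (hlam : 0 < lam) (w : E × E) (b : E) :
    |inner ℝ (w.1 - b) (noiseTo lam w b)| ≤ lam⁻¹ * (3 * energy lam w b + ‖w.2‖ ^ 2 / 2) := by
  have e : w.1 - b = lam⁻¹ • (noiseTo lam w b - w.2) := by
    rw [noiseTo, add_sub_cancel_right, inv_smul_smul₀ hlam.ne']
  have h : |inner ℝ (noiseTo lam w b - w.2) (noiseTo lam w b)|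
      ≤ 3 * energy lam w b + ‖w.2‖ ^ 2 / 2 := by
    refine (abs_real_inner_le_norm _ _).trans ?_
    have h1 := norm_sub_le (noiseTo lam w b) w.2
    unfold energy
    nlinarith [norm_nonneg (noiseTo lam w b), norm_nonneg w.2,
      sq_nonneg (‖noiseTo lam w b‖ - ‖w.2‖)]
  nth_rewrite 1 [e]
  rw [real_inner_smul_left, abs_mul, abs_of_pos (inv_pos.2 hlam)]
  gcongr

theorem continuous_exp_neg_energy (b : E) (w : E × E) :
    Continuous fun lam => Real.exp (-energy lam w b) :=
  Real.continuous_exp.comp (continuous_energy.comp (by fun_prop : Continuous fun lam : ℝ =>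
    (lam, w, b))).neg

theorem energy_le (lam : ℝ) (w : E × E) (b : E) :
    energy lam w b ≤ 2 * lam ^ 2 * (‖w.1‖ ^ 2 + ‖b‖ ^ 2) + ‖w.2‖ ^ 2 := by
  have h1 := norm_add_le (lam • (w.1 - b)) w.2
  have h2 := norm_sub_le w.1 b
  rw [norm_smul, Real.norm_eq_abs] at h1
  have h3 : |lam| * ‖w.1 - b‖ ≤ |lam| * (‖w.1‖ + ‖b‖) := by gcongr
  have h4 : ‖noiseTo lam w b‖ ≤ |lam| * (‖w.1‖ + ‖b‖) + ‖w.2‖ := h1.trans (by linarith)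
  have h5 : ‖noiseTo lam w b‖ ^ 2 ≤ (|lam| * (‖w.1‖ + ‖b‖) + ‖w.2‖) ^ 2 := by gcongr
  have h6 : (|lam| * (‖w.1‖ + ‖b‖) + ‖w.2‖) ^ 2
      ≤ 2 * (|lam| * (‖w.1‖ + ‖b‖)) ^ 2 + 2 * ‖w.2‖ ^ 2 := by
    nlinarith [sq_nonneg (|lam| * (‖w.1‖ + ‖b‖) - ‖w.2‖)]
  have h7 : (|lam| * (‖w.1‖ + ‖b‖)) ^ 2 ≤ lam ^ 2 * (2 * (‖w.1‖ ^ 2 + ‖b‖ ^ 2)) := by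
    rw [mul_pow, sq_abs]
    gcongr
    nlinarith [sq_nonneg (‖w.1‖ - ‖b‖)]
  unfold energy
  linarith

variable [MeasurableSpace E]

/-- The density at the observation `λ a + z`, up to normalization, when the data have law `p`. -/
noncomputable def evidence (p : Measure E) (lam : ℝ) (w : E × E) : ℝ :=
  ∫ b, Real.exp (-energy lam w b) ∂p

/-- The posterior mean of the derivative of the energy in `λ`. -/
noncomputable def posteriorSlope (p : Measure E) (lam : ℝ) (w : E × E) : ℝ :=
  (∫ b, inner ℝ (w.1 - b) (noiseTo lam w b) * Real.exp (-energy lam w b) ∂p) / evidence p lam w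

variable [BorelSpace E] [SecondCountableTopology E]

theorem measurable_energy (lam : ℝ) :
    Measurable fun q : (E × E) × E => energy lam q.1 q.2 := by
  have h : Continuous fun q : (E × E) × E => energy lam q.1 q.2 :=
    continuous_energy.comp (continuous_const.prodMk continuous_id)
  exact h.measurable

theorem measurable_noiseTo (lam : ℝ) :
    Measurable fun q : (E × E) × E => noiseTo lam q.1 q.2 := by
  have h : Continuous fun q : (E × E) × E => noiseTo lam q.1 q.2 :=
    continuous_noiseTo.comp (continuous_const.prodMk continuous_id)
  exact h.measurable

variable (p : Measure E) [IsProbabilityMeasure p]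

theorem measurable_evidence (lam : ℝ) : Measurable (evidence p lam) :=
  (StronglyMeasurable.integral_prod_right (ν := p)
    (measurable_energy lam).neg.exp.stronglyMeasurable).measurable

theorem measurable_posteriorSlope (lam : ℝ) : Measurable (posteriorSlope p lam) := by
  refine Measurable.div ?_ (measurable_evidence p lam)
  have h : Measurable fun q : (E × E) × E =>
      inner ℝ (q.1.1 - q.2) (noiseTo lam q.1 q.2) * Real.exp (-energy lam q.1 q.2) :=
    ((measurable_fst.fst.sub measurable_snd).inner (measurable_noiseTo lam)).mul
      (measurable_energy lam).neg.exp
  exact (StronglyMeasurable.integral_prod_right (ν := p) h.stronglyMeasurable).measurable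

omit [IsProbabilityMeasure p] in
theorem aestronglyMeasurable_energy (lam : ℝ) (w : E × E) :
    AEStronglyMeasurable (energy lam w) p :=
  ((measurable_energy lam).comp measurable_prodMk_left).aestronglyMeasurable

theorem integrable_exp_neg_energy (lam : ℝ) (w : E × E) :
    Integrable (fun b => Real.exp (-energy lam w b)) p :=
  Integrable.of_bound (aestronglyMeasurable_energy p lam w).neg.aemeasurable.exp.aestronglyMeasurable
    1 (ae_of_all _ fun b => by
      rw [Real.norm_eq_abs, Real.abs_exp]
      exact Real.exp_le_one_iff.2 (neg_nonpos.2 (energy_nonneg _ _ _)))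

theorem evidence_pos (lam : ℝ) (w : E × E) : 0 < evidence p lam w :=
  integral_exp_pos (integrable_exp_neg_energy p lam w)

theorem evidence_le_one (lam : ℝ) (w : E × E) : evidence p lam w ≤ 1 := by
  have h := integral_mono (integrable_exp_neg_energy p lam w) (integrable_const 1) fun b =>
    Real.exp_le_one_iff.2 (neg_nonpos.2 (energy_nonneg lam w b))
  simpa [evidence] using h

theorem log_evidence_nonpos (lam : ℝ) (w : E × E) : Real.log (evidence p lam w) ≤ 0 :=
  Real.log_nonpos (evidence_pos p lam w).le (evidence_le_one p lam w)

theorem continuous_evidence (w : E × E) : Continuous fun lam => evidence p lam w :=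
  continuous_of_dominated (bound := fun _ => 1)
    (fun lam => (integrable_exp_neg_energy p lam w).1)
    (fun lam => ae_of_all _ fun b => by
      rw [Real.norm_eq_abs, Real.abs_exp]
      exact Real.exp_le_one_iff.2 (neg_nonpos.2 (energy_nonneg _ _ _)))
    (integrable_const _) (ae_of_all _ fun b => continuous_exp_neg_energy b w)

variable {p}

omit [InnerProductSpace ℝ E] in
theorem integrable_norm_sub (hp : Integrable (fun x => ‖x‖ ^ 2) p) (a : E) :
    Integrable (fun b => ‖a - b‖) p := by
  have h : MemLp (fun x : E => x) 2 p :=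
    (memLp_two_iff_integrable_sq_norm continuous_id.aestronglyMeasurable).2 hp
  exact ((integrable_const a).sub (h.integrable (by norm_num))).norm

theorem aestronglyMeasurable_inner_mul_exp (lam : ℝ) (w : E × E) :
    AEStronglyMeasurable
      (fun b => inner ℝ (w.1 - b) (noiseTo lam w b) * Real.exp (-energy lam w b)) p := by
  have h : Measurable fun b => noiseTo lam w b :=
    (measurable_noiseTo lam).comp measurable_prodMk_left
  exact ((measurable_const.sub measurable_id).inner h).aestronglyMeasurable.mul
    (integrable_exp_neg_energy p lam w).1

theorem hasDerivAt_evidence (hp : Integrable (fun x => ‖x‖ ^ 2) p) (lam : ℝ) (w : E × E) :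
    HasDerivAt (fun lam => evidence p lam w)
      (-∫ b, inner ℝ (w.1 - b) (noiseTo lam w b) * Real.exp (-energy lam w b) ∂p) lam := by
  rw [← integral_neg]
  refine (hasDerivAt_integral_of_dominated_loc_of_deriv_le (s := univ) (bound := fun b => ‖w.1 - b‖)
    (F' := fun lam b => -(inner ℝ (w.1 - b) (noiseTo lam w b) * Real.exp (-energy lam w b)))
    univ_mem (Eventually.of_forall fun lam => (integrable_exp_neg_energy p lam w).1)
    (integrable_exp_neg_energy p lam w) (aestronglyMeasurable_inner_mul_exp lam w).neg
    (ae_of_all _ fun b lam _ => ?_) (integrable_norm_sub hp _) (ae_of_all _ fun b lam _ => ?_)).2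
  · rw [norm_neg]
    exact abs_inner_mul_exp_le lam w b
  · refine ((hasDerivAt_energy lam w b).neg.exp).congr_deriv ?_
    simp
    ring

theorem hasDerivAt_log_evidence (hp : Integrable (fun x => ‖x‖ ^ 2) p) (lam : ℝ) (w : E × E) :
    HasDerivAt (fun lam => Real.log (evidence p lam w)) (-posteriorSlope p lam w) lam := by
  refine ((hasDerivAt_evidence hp lam w).log (evidence_pos p lam w).ne').congr_deriv ?_
  rw [posteriorSlope, neg_div]

theorem continuous_posteriorSlope (hp : Integrable (fun x => ‖x‖ ^ 2) p) (w : E × E) :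
    Continuous fun lam => posteriorSlope p lam w := by
  refine Continuous.div ?_ (continuous_evidence p w) fun lam => (evidence_pos p lam w).ne'
  refine continuous_of_dominated (bound := fun b => ‖w.1 - b‖)
    (fun lam => aestronglyMeasurable_inner_mul_exp lam w)
    (fun lam => ae_of_all _ fun b => abs_inner_mul_exp_le lam w b) (integrable_norm_sub hp _)
    (ae_of_all _ fun b => ?_)
  have h : Continuous fun lam => noiseTo lam w b :=
    continuous_noiseTo.comp (by fun_prop : Continuous fun lam : ℝ => (lam, w, b))
  exact (continuous_const.inner h).mul (continuous_exp_neg_energy b w)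

/-- A bound for the prior mean of the energy, as a function of `w = (a, z)`. -/
noncomputable def energyBound (p : Measure E) (lam : ℝ) (w : E × E) : ℝ :=
  2 * lam ^ 2 * (‖w.1‖ ^ 2 + ∫ b, ‖b‖ ^ 2 ∂p) + ‖w.2‖ ^ 2

theorem integrable_energy (hp : Integrable (fun x => ‖x‖ ^ 2) p) (lam : ℝ) (w : E × E) :
    Integrable (energy lam w) p :=
  ((((integrable_const (‖w.1‖ ^ 2)).add hp).const_mul (2 * lam ^ 2)).add
    (integrable_const (‖w.2‖ ^ 2))).mono' (aestronglyMeasurable_energy p lam w)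
    (ae_of_all _ fun b => by
      rw [Real.norm_of_nonneg (energy_nonneg _ _ _)]; exact energy_le lam w b)

theorem integral_energy_le (hp : Integrable (fun x => ‖x‖ ^ 2) p) (lam : ℝ) (w : E × E) :
    ∫ b, energy lam w b ∂p ≤ energyBound p lam w := by
  have hi : Integrable (fun b => ‖w.1‖ ^ 2 + ‖b‖ ^ 2) p := (integrable_const (‖w.1‖ ^ 2)).add hp
  refine (integral_mono (integrable_energy hp lam w) ((hi.const_mul (2 * lam ^ 2)).add
    (integrable_const (‖w.2‖ ^ 2))) fun b => energy_le lam w b).trans_eq ?_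
  simp only [Pi.add_apply]
  rw [integral_add (hi.const_mul _) (integrable_const _), integral_const_mul,
    integral_add (integrable_const _) hp]
  simp [energyBound]

theorem abs_log_evidence_le (hp : Integrable (fun x => ‖x‖ ^ 2) p) (lam : ℝ) (w : E × E) :
    |Real.log (evidence p lam w)| ≤ energyBound p lam w := by
  rw [abs_of_nonpos (log_evidence_nonpos p lam w), neg_le]
  rw [Real.le_log_iff_exp_le (evidence_pos p lam w)]
  refine le_trans ?_ (exp_neg_integral_le (integrable_energy hp lam w) (energy_nonneg lam w))
  exact Real.exp_le_exp.2 (neg_le_neg (integral_energy_le hp lam w))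

/-- The evidence in the denominator can be tiny; `integral_mul_exp_neg_le` cancels it, and what
remains is integrable in `w`. -/
theorem abs_posteriorSlope_le (hp : Integrable (fun x => ‖x‖ ^ 2) p) {lam : ℝ} (hlam : 0 < lam)
    (w : E × E) :
    |posteriorSlope p lam w| ≤ lam⁻¹ * (3 * energyBound p lam w + ‖w.2‖ ^ 2 / 2) := by
  have hi := integrable_exp_neg_energy p lam w
  have hv := integrable_energy hp lam w
  have hvE : Integrable (fun b => energy lam w b * Real.exp (-energy lam w b)) p :=
    hv.mono (hv.1.mul hi.1) (ae_of_all _ fun b => by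
      rw [norm_mul, Real.norm_eq_abs (Real.exp _), Real.abs_exp]
      exact mul_le_of_le_one_right (norm_nonneg _)
        (Real.exp_le_one_iff.2 (neg_nonpos.2 (energy_nonneg _ _ _))))
  rw [posteriorSlope, abs_div, abs_of_pos (evidence_pos p lam w), div_le_iff₀ (evidence_pos p lam w)]
  have h1 := integral_mul_exp_neg_le hv (energy_nonneg lam w)
  have h2 := mul_le_mul_of_nonneg_right (integral_energy_le hp lam w) (evidence_pos p lam w).le
  have hb : Integrable (fun b => lam⁻¹ * (3 * (energy lam w b * Real.exp (-energy lam w b))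
      + ‖w.2‖ ^ 2 / 2 * Real.exp (-energy lam w b))) p :=
    ((hvE.const_mul 3).add (hi.const_mul _)).const_mul _
  rw [← Real.norm_eq_abs]
  refine (norm_integral_le_of_norm_le hb (ae_of_all _ fun b => ?_)).trans ?_
  · rw [norm_mul, Real.norm_eq_abs, Real.norm_eq_abs, Real.abs_exp]
    calc _ ≤ lam⁻¹ * (3 * energy lam w b + ‖w.2‖ ^ 2 / 2) * Real.exp (-energy lam w b) := by
          gcongr; exact abs_inner_noiseTo_le hlam w b
      _ = _ := by ring
  · rw [integral_const_mul, integral_add (hvE.const_mul 3) (hi.const_mul _), integral_const_mul,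
      integral_const_mul, mul_assoc]
    refine mul_le_mul_of_nonneg_left ?_ (inv_pos.2 hlam).le
    change _ + _ * evidence p lam w ≤ _
    have h3 := h1.trans h2
    linarith

end Evidence

/-! ### The Lebesgue density of the standard Gaussian measure. -/

section GaussianDensity

variable {E : Type*} [NormedAddCommGroup E] [InnerProductSpace ℝ E] [FiniteDimensional ℝ E]
  [MeasurableSpace E] [BorelSpace E]

/-- The density of the standard Gaussian measure. -/
noncomputable def stdGaussianDensity (z : E) : ℝ :=
  ((2 * Real.pi) ^ (Module.finrank ℝ E / 2 : ℝ))⁻¹ * Real.exp (-(‖z‖ ^ 2 / 2))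

omit [FiniteDimensional ℝ E] [MeasurableSpace E] [BorelSpace E] in
theorem stdGaussianDensity_pos (z : E) : 0 < stdGaussianDensity z := by
  unfold stdGaussianDensity
  have := Real.pi_pos
  positivity

omit [FiniteDimensional ℝ E] [MeasurableSpace E] [BorelSpace E] in
theorem continuous_stdGaussianDensity : Continuous (stdGaussianDensity (E := E)) := by
  unfold stdGaussianDensity
  fun_prop

omit [FiniteDimensional ℝ E] in
theorem measurable_ofReal_stdGaussianDensity :
    Measurable fun z : E => ENNReal.ofReal (stdGaussianDensity z) :=
  continuous_stdGaussianDensity.measurable.ennreal_ofReal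

theorem integrable_stdGaussianDensity : Integrable (stdGaussianDensity (E := E)) := by
  have h := (GaussianFourier.integrable_cexp_neg_mul_sq_norm_add (V := E) (b := 1 / 2) (by simp)
    0 0).re
  refine (h.const_mul ((2 * Real.pi) ^ (Module.finrank ℝ E / 2 : ℝ))⁻¹).congr
    (Filter.Eventually.of_forall fun z => ?_)
  have : (-(1 / 2 : ℂ) * ‖z‖ ^ 2 + 0 * (inner ℝ (0 : E) z : ℝ)) = ((-(‖z‖ ^ 2 / 2) : ℝ) : ℂ) := by
    push_cast; ring
  simp only [this, ← Complex.ofReal_exp]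
  rfl

/-- Both sides have the same characteristic function. The density is needed in order to translate
the noise under Lebesgue measure. -/
theorem stdGaussian_eq_withDensity :
    stdGaussian E = volume.withDensity fun z => ENNReal.ofReal (stdGaussianDensity z) := by
  have := isFiniteMeasure_withDensity_ofReal (integrable_stdGaussianDensity (E := E)).2
  refine Measure.ext_of_charFun (funext fun t => ?_)
  have hpi := Real.pi_pos
  have h := GaussianFourier.integral_cexp_neg_mul_sq_norm_add (V := E) (b := 1 / 2) (by simp)
    Complex.I t
  have hc : ((2 * Real.pi : ℝ) ^ (Module.finrank ℝ E / 2 : ℝ) : ℝ) =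
      (Real.pi / (1 / 2 : ℂ)) ^ (Module.finrank ℝ E / 2 : ℂ) := by
    rw [Complex.ofReal_cpow (by positivity)]
    push_cast
    congr 1
    ring
  have hc0 : (((2 * Real.pi : ℝ) ^ (Module.finrank ℝ E / 2 : ℝ) : ℝ) : ℂ) ≠ 0 :=
    Complex.ofReal_ne_zero.2 (by positivity)
  rw [charFun_stdGaussian, charFun_apply,
    integral_withDensity_eq_integral_toReal_smul measurable_ofReal_stdGaussianDensity
      (ae_of_all _ fun _ => ENNReal.ofReal_lt_top)]
  have e : ∀ x : E, (ENNReal.ofReal (stdGaussianDensity x)).toReal •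
      Complex.exp ((inner ℝ x t : ℝ) * Complex.I) =
      (((2 * Real.pi : ℝ) ^ (Module.finrank ℝ E / 2 : ℝ) : ℝ) : ℂ)⁻¹ *
      Complex.exp (-(1 / 2) * ‖x‖ ^ 2 + Complex.I * (inner ℝ t x : ℝ)) := by
    intro x
    rw [ENNReal.toReal_ofReal (stdGaussianDensity_pos x).le, stdGaussianDensity,
      Complex.real_smul, Complex.exp_add, real_inner_comm]
    push_cast
    rw [mul_comm Complex.I, mul_assoc]
    congr 3
    ring_nf
  simp_rw [e]
  rw [integral_const_mul, h, ← hc, inv_mul_cancel_left₀ hc0]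
  congr 1
  rw [Complex.I_sq]
  ring

theorem integrable_norm_sq_stdGaussian : Integrable (fun z : E => ‖z‖ ^ 2) (stdGaussian E) :=
  (memLp_two_iff_integrable_sq_norm continuous_id.aestronglyMeasurable).1
    (IsGaussian.memLp_two_id (μ := stdGaussian E))

end GaussianDensity

/-! ### Replicas drawn from the posterior and their exchangeability. -/

section Posterior

open Filter Topology

variable {E : Type*} [NormedAddCommGroup E] [InnerProductSpace ℝ E]

/-- The exchange of the data `a` and `b` that explain the same observation `λ a + z`. -/
def exchangeData (lam : ℝ) (q : (E × E) × E) : (E × E) × E :=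
  ((q.2, noiseTo lam q.1 q.2), q.1.1)

/-- The exchange preserves the observation `λ a + z`, and the noise towards `c` depends on `(a, z)`
only through it. -/
theorem noiseTo_exchangeData (lam : ℝ) (q : (E × E) × E) (c : E) :
    noiseTo lam (exchangeData lam q).1 c = noiseTo lam q.1 c := by
  simp only [noiseTo, exchangeData]
  rw [← add_assoc, ← smul_add]
  congr 2
  abel

theorem noiseTo_self (lam : ℝ) (w : E × E) : noiseTo lam w w.1 = w.2 := by
  simp [noiseTo]

theorem energy_exchangeData (lam : ℝ) (q : (E × E) × E) (c : E) :
    energy lam (exchangeData lam q).1 c = energy lam q.1 c := by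
  rw [energy, energy, noiseTo_exchangeData]

variable [FiniteDimensional ℝ E] [MeasurableSpace E] [BorelSpace E]

omit [FiniteDimensional ℝ E] [BorelSpace E] in
theorem evidence_exchangeData (p : Measure E) (lam : ℝ) (q : (E × E) × E) :
    evidence p lam (exchangeData lam q).1 = evidence p lam q.1 := by
  simp only [evidence, energy_exchangeData]

theorem measurable_exchangeData (lam : ℝ) : Measurable (exchangeData (E := E) lam) :=
  (measurable_snd.prodMk (measurable_noiseTo lam)).prodMk measurable_fst.fst

/-- The posterior density of the datum `b`, given the observation `λ a + z`. -/
noncomputable def posteriorDensity (p : Measure E) (lam : ℝ) (q : (E × E) × E) : ℝ :=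
  Real.exp (-energy lam q.1 q.2) / evidence p lam q.1

/-- The law of `((a, z), b)`, where `b` is drawn from the posterior given `λ a + z`. -/
noncomputable def replicaLaw (p : Measure E) (lam : ℝ) : Measure ((E × E) × E) :=
  ((p.prod (stdGaussian E)).prod p).withDensity fun q => ENNReal.ofReal (posteriorDensity p lam q)

variable (p : Measure E) [IsProbabilityMeasure p] (lam : ℝ)

theorem posteriorDensity_pos (q : (E × E) × E) : 0 < posteriorDensity p lam q :=
  div_pos (Real.exp_pos _) (evidence_pos p lam _)

theorem measurable_posteriorDensity : Measurable (posteriorDensity p lam) :=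
  (measurable_energy lam).neg.exp.div ((measurable_evidence p lam).comp measurable_fst)

theorem lintegral_posteriorDensity (w : E × E) :
    ∫⁻ b, ENNReal.ofReal (posteriorDensity p lam (w, b)) ∂p = 1 := by
  rw [← ofReal_integral_eq_lintegral_ofReal]
  · simp only [posteriorDensity]
    rw [integral_div, ← evidence, div_self (evidence_pos p lam w).ne', ENNReal.ofReal_one]
  · exact (integrable_exp_neg_energy p lam w).div_const (evidence p lam w)
  · exact ae_of_all _ fun b => (posteriorDensity_pos p lam _).le

theorem map_fst_replicaLaw : (replicaLaw p lam).map Prod.fst = p.prod (stdGaussian E) := by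
  refine Measure.ext_of_lintegral _ fun f hf => ?_
  have hq := (measurable_posteriorDensity p lam).ennreal_ofReal
  have hf' : Measurable fun q : (E × E) × E => f q.1 := hf.comp measurable_fst
  rw [lintegral_map hf measurable_fst, replicaLaw,
    lintegral_withDensity_eq_lintegral_mul _ hq hf',
    lintegral_prod _ (hq.mul hf').aemeasurable]
  refine lintegral_congr fun w => ?_
  simp only [Pi.mul_apply]
  have hq' : Measurable fun b => ENNReal.ofReal (posteriorDensity p lam (w, b)) :=
    hq.comp measurable_prodMk_left
  rw [lintegral_mul_const _ hq', lintegral_posteriorDensity, one_mul]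

theorem measurePreserving_fst_replicaLaw :
    MeasurePreserving Prod.fst (replicaLaw p lam) (p.prod (stdGaussian E)) :=
  ⟨measurable_fst, map_fst_replicaLaw p lam⟩

/-- The noise is integrated innermost and against Lebesgue measure, so that it can be translated
with both data fixed. -/
theorem lintegral_replicaLaw {f : (E × E) × E → ℝ≥0∞} (hf : Measurable f) :
    ∫⁻ q, f q ∂replicaLaw p lam = ∫⁻ a, ∫⁻ b, ∫⁻ z,
      ENNReal.ofReal (stdGaussianDensity z * posteriorDensity p lam ((a, z), b)) * f ((a, z), b)
        ∂(volume : Measure E) ∂p ∂p := by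
  have hq := (measurable_posteriorDensity p lam).ennreal_ofReal
  rw [replicaLaw, lintegral_withDensity_eq_lintegral_mul _ hq hf,
    lintegral_prod _ (hq.mul hf).aemeasurable,
    lintegral_prod _ (hq.mul hf).lintegral_prod_right'.aemeasurable]
  refine lintegral_congr fun a => ?_
  have hm : Measurable fun r : E × E => ((a, r.1), r.2) := by fun_prop
  rw [lintegral_lintegral_swap (f := fun z b =>
    ((fun q => ENNReal.ofReal (posteriorDensity p lam q)) * f) ((a, z), b))
    ((hq.mul hf).comp hm).aemeasurable]
  refine lintegral_congr fun b => ?_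
  have hz : Measurable fun z : E =>
      ((fun q => ENNReal.ofReal (posteriorDensity p lam q)) * f) ((a, z), b) :=
    (hq.mul hf).comp (by fun_prop : Measurable fun z : E => ((a, z), b))
  rw [stdGaussian_eq_withDensity, lintegral_withDensity_eq_lintegral_mul _
    measurable_ofReal_stdGaussianDensity hz]
  refine lintegral_congr fun z => ?_
  simp only [Pi.mul_apply]
  rw [ENNReal.ofReal_mul (stdGaussianDensity_pos z).le, mul_assoc]

/-- Up to a constant, the density of `((a, z), b)` is `exp (-‖z‖² / 2) exp (-‖λ (a - b) + z‖² / 2) /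
Z`, with `Z` a function of the observation. The exchange swaps the two exponentials and keeps `Z`.
-/
theorem measurePreserving_exchangeData :
    MeasurePreserving (exchangeData lam) (replicaLaw p lam) (replicaLaw p lam) := by
  refine ⟨measurable_exchangeData lam, Measure.ext_of_lintegral _ fun f hf => ?_⟩
  have hD : Measurable fun q : (E × E) × E =>
      ENNReal.ofReal (stdGaussianDensity q.1.2 * posteriorDensity p lam q) :=
    ((continuous_stdGaussianDensity.measurable.comp measurable_fst.snd).mul
      (measurable_posteriorDensity p lam)).ennreal_ofReal
  rw [lintegral_map hf (measurable_exchangeData lam),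
    lintegral_replicaLaw p lam (f := fun q => f (exchangeData lam q))
      (hf.comp (measurable_exchangeData lam)),
    lintegral_replicaLaw p lam hf]
  have hm : Measurable fun r : (E × E) × E => ((r.1.1, r.2), r.1.2) := by fun_prop
  rw [lintegral_lintegral_swap (f := fun a b => ∫⁻ z,
      ENNReal.ofReal (stdGaussianDensity z * posteriorDensity p lam ((a, z), b)) * f ((a, z), b))
    (((hD.mul hf).comp hm).lintegral_prod_right').aemeasurable]
  refine lintegral_congr fun a => lintegral_congr fun b => ?_
  -- With the names of the data swapped, the exchange is a translation of the noise by `λ (a - b)`.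
  refine Eq.trans ?_ (lintegral_add_left_eq_self _ (lam • (a - b)))
  refine lintegral_congr fun z => ?_
  have e : exchangeData lam ((a, z), b) = ((b, lam • (a - b) + z), a) := rfl
  have h1 : energy lam (b, lam • (a - b) + z) a = ‖z‖ ^ 2 / 2 := by
    have h := energy_exchangeData lam ((a, z), b) a
    rw [e] at h
    rw [h, energy, noiseTo_self lam (a, z)]
  have h2 : evidence p lam (b, lam • (a - b) + z) = evidence p lam (a, z) := by
    have h := evidence_exchangeData p lam ((a, z), b)
    rwa [e] at h
  have h3 : energy lam (a, z) b = ‖lam • (a - b) + z‖ ^ 2 / 2 := rfl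
  rw [e]
  congr 2
  simp only [stdGaussianDensity, posteriorDensity, h1, h2, h3]
  ring

end Posterior

/-! ### The mean squared distance of datum and replica. -/

section Dispersion

open Filter Topology

variable {E : Type*} [NormedAddCommGroup E] [InnerProductSpace ℝ E] [FiniteDimensional ℝ E]
  [MeasurableSpace E] [BorelSpace E]

/-- The mean squared distance of two independent draws from the posterior. -/
noncomputable def dispersion (p : Measure E) (lam : ℝ) : ℝ :=
  ∫ q, ‖q.1.1 - q.2‖ ^ 2 ∂replicaLaw p lam

omit [BorelSpace E] in
theorem dispersion_nonneg (p : Measure E) (lam : ℝ) : 0 ≤ dispersion p lam :=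
  integral_nonneg fun _ => by positivity

variable (E) in
/-- The second moment of the standard Gaussian measure. -/
noncomputable def stdGaussianMoment : ℝ := ∫ z : E, ‖z‖ ^ 2 ∂stdGaussian E

variable (p : Measure E) [IsProbabilityMeasure p] (lam : ℝ)

theorem integrable_norm_sq_snd :
    Integrable (fun w : E × E => ‖w.2‖ ^ 2) (p.prod (stdGaussian E)) :=
  integrable_norm_sq_stdGaussian.comp_snd p

theorem integral_norm_sq_snd :
    ∫ w : E × E, ‖w.2‖ ^ 2 ∂p.prod (stdGaussian E) = stdGaussianMoment E := by
  rw [integral_fun_snd (fun z : E => ‖z‖ ^ 2)]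
  simp [stdGaussianMoment]

theorem integrable_norm_sq_noise :
    Integrable (fun q : (E × E) × E => ‖q.1.2‖ ^ 2) (replicaLaw p lam) :=
  (measurePreserving_fst_replicaLaw p lam).integrable_comp_of_integrable
    (g := fun w : E × E => ‖w.2‖ ^ 2) (integrable_norm_sq_snd p)

theorem integral_norm_sq_noise :
    ∫ q, ‖q.1.2‖ ^ 2 ∂replicaLaw p lam = stdGaussianMoment E := by
  rw [← integral_norm_sq_snd p, ← map_fst_replicaLaw p lam,
    integral_map measurable_fst.aemeasurable (by fun_prop)]

theorem integral_comp_exchangeData {f : (E × E) × E → ℝ}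
    (hf : AEStronglyMeasurable f (replicaLaw p lam)) :
    ∫ q, f (exchangeData lam q) ∂replicaLaw p lam = ∫ q, f q ∂replicaLaw p lam := by
  have h := measurePreserving_exchangeData p lam
  conv_rhs => rw [← h.map_eq]
  rw [integral_map h.aemeasurable (by rwa [h.map_eq])]

/-- The noise towards the replica is the noise of the exchanged triple, hence also standard
Gaussian; no moment of `p` is used. -/
theorem integrable_norm_sq_noiseTo :
    Integrable (fun q : (E × E) × E => ‖noiseTo lam q.1 q.2‖ ^ 2) (replicaLaw p lam) :=
  (measurePreserving_exchangeData p lam).integrable_comp_of_integrable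
    (g := fun q : (E × E) × E => ‖q.1.2‖ ^ 2) (integrable_norm_sq_noise p lam)

theorem integral_norm_sq_noiseTo :
    ∫ q, ‖noiseTo lam q.1 q.2‖ ^ 2 ∂replicaLaw p lam = stdGaussianMoment E := by
  rw [← integral_norm_sq_noise p lam,
    ← integral_comp_exchangeData p lam (integrable_norm_sq_noise p lam).1]
  rfl

omit [FiniteDimensional ℝ E] [MeasurableSpace E] [BorelSpace E] in
theorem sq_mul_norm_sub_sq_le (q : (E × E) × E) :
    lam ^ 2 * ‖q.1.1 - q.2‖ ^ 2 ≤ 2 * (‖noiseTo lam q.1 q.2‖ ^ 2 + ‖q.1.2‖ ^ 2) := by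
  have e : lam • (q.1.1 - q.2) = noiseTo lam q.1 q.2 - q.1.2 := by simp [noiseTo]
  have h1 : lam ^ 2 * ‖q.1.1 - q.2‖ ^ 2 = ‖noiseTo lam q.1 q.2 - q.1.2‖ ^ 2 := by
    rw [← e, norm_smul, mul_pow, Real.norm_eq_abs, sq_abs]
  have h2 := norm_sub_le (noiseTo lam q.1 q.2) q.1.2
  have h3 := pow_le_pow_left₀ (norm_nonneg _) h2 2
  rw [h1]
  nlinarith [sq_nonneg (‖noiseTo lam q.1 q.2‖ - ‖q.1.2‖)]

/-- The bound is uniform in `lam`; it keeps the rate of the rescaled entropy bounded as the noise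
vanishes. -/
theorem sq_mul_dispersion_le : lam ^ 2 * dispersion p lam ≤ 4 * stdGaussianMoment E := by
  rw [dispersion, ← integral_const_mul]
  refine (integral_mono_of_nonneg (ae_of_all _ fun q => by positivity)
    (((integrable_norm_sq_noiseTo p lam).add (integrable_norm_sq_noise p lam)).const_mul 2)
    (ae_of_all _ fun q => sq_mul_norm_sub_sq_le lam q)).trans_eq ?_
  simp only [Pi.add_apply]
  rw [integral_const_mul,
    integral_add (integrable_norm_sq_noiseTo p lam) (integrable_norm_sq_noise p lam),
    integral_norm_sq_noiseTo, integral_norm_sq_noise]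
  ring

variable {lam}

theorem integrable_norm_sub_sq (hlam : 0 < lam) :
    Integrable (fun q : (E × E) × E => ‖q.1.1 - q.2‖ ^ 2) (replicaLaw p lam) := by
  refine ((((integrable_norm_sq_noiseTo p lam).add (integrable_norm_sq_noise p lam)).const_mul
    2).const_mul (lam ^ 2)⁻¹).mono' (by fun_prop) (ae_of_all _ fun q => ?_)
  rw [Real.norm_of_nonneg (by positivity), le_inv_mul_iff₀ (by positivity)]
  exact sq_mul_norm_sub_sq_le lam q

theorem integrable_inner_noiseTo (hlam : 0 < lam) :
    Integrable (fun q : (E × E) × E => inner ℝ (q.1.1 - q.2) (noiseTo lam q.1 q.2))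
      (replicaLaw p lam) := by
  refine ((integrable_norm_sub_sq p hlam).add (integrable_norm_sq_noiseTo p lam)).mono'
    ((measurable_fst.fst.sub measurable_snd).inner
      (measurable_noiseTo lam)).aestronglyMeasurable (ae_of_all _ fun q => ?_)
  refine (abs_real_inner_le_norm _ _).trans ?_
  simp only [Pi.add_apply]
  nlinarith [sq_nonneg (‖q.1.1 - q.2‖ - ‖noiseTo lam q.1 q.2‖), sq_nonneg ‖q.1.1 - q.2‖,
    sq_nonneg ‖noiseTo lam q.1 q.2‖]

/-- The exchange turns the integrand into `-⟨a - b, z⟩`, and the two versions add up to `lam * ‖a -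
b‖ ^ 2`. -/
theorem integral_inner_noiseTo (hlam : 0 < lam) :
    ∫ q, inner ℝ (q.1.1 - q.2) (noiseTo lam q.1 q.2) ∂replicaLaw p lam =
      lam / 2 * dispersion p lam := by
  have hi := integrable_inner_noiseTo p hlam
  have hi' := (measurePreserving_exchangeData p lam).integrable_comp_of_integrable hi
  have h := integral_comp_exchangeData p lam hi.1
  have hsum := integral_add hi hi'
  simp only [Function.comp_apply] at hsum
  have e : ∀ q : (E × E) × E, inner ℝ (q.1.1 - q.2) (noiseTo lam q.1 q.2)
      + inner ℝ ((exchangeData lam q).1.1 - (exchangeData lam q).2)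
        (noiseTo lam (exchangeData lam q).1 (exchangeData lam q).2)
      = lam * ‖q.1.1 - q.2‖ ^ 2 := by
    intro q
    rw [noiseTo_exchangeData]
    have e1 : noiseTo lam q.1 (exchangeData lam q).2 = q.1.2 := noiseTo_self lam q.1
    have e2 : (exchangeData lam q).1.1 - (exchangeData lam q).2 = -(q.1.1 - q.2) := by
      simp [exchangeData]
    rw [e1, e2, inner_neg_left, ← sub_eq_add_neg, ← inner_sub_right, noiseTo,
      add_sub_cancel_right, real_inner_smul_right, real_inner_self_eq_norm_sq]
  simp_rw [e] at hsum
  rw [integral_const_mul, h] at hsum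
  rw [dispersion]
  linarith

theorem integral_posteriorSlope (hlam : 0 < lam) :
    ∫ w, posteriorSlope p lam w ∂p.prod (stdGaussian E) = lam / 2 * dispersion p lam := by
  have hm := (measurable_posteriorDensity p lam).ennreal_ofReal
  have hi := integrable_inner_noiseTo p hlam
  rw [← integral_inner_noiseTo p hlam]
  rw [replicaLaw] at hi ⊢
  rw [integrable_withDensity_iff_integrable_smul' hm
    (ae_of_all _ fun _ => ENNReal.ofReal_lt_top)] at hi
  rw [integral_withDensity_eq_integral_toReal_smul hm
    (ae_of_all _ fun _ => ENNReal.ofReal_lt_top), integral_prod _ hi]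
  refine integral_congr_ae (ae_of_all _ fun w => ?_)
  simp only [ENNReal.toReal_ofReal (posteriorDensity_pos p lam _).le, smul_eq_mul, posteriorSlope]
  rw [← integral_div]
  refine integral_congr_ae (ae_of_all _ fun b => ?_)
  simp only [posteriorDensity]
  ring

/-- Since the posterior density is positive, zero dispersion forces, for some fixed `a`, that
`p`-almost every `b` equals `a`. -/
theorem dispersion_pos (hlam : 0 < lam) (hp : ∀ a, p ≠ Measure.dirac a) :
    0 < dispersion p lam := by
  refine (dispersion_nonneg p lam).lt_of_ne fun h => ?_
  rw [dispersion, eq_comm, integral_eq_zero_iff_of_nonneg (fun q => by positivity)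
    (integrable_norm_sub_sq p hlam), replicaLaw, Filter.EventuallyEq,
    ae_withDensity_iff (measurable_posteriorDensity p lam).ennreal_ofReal] at h
  obtain ⟨w, hw⟩ := (Measure.ae_ae_of_ae_prod h).exists
  have hconst : id =ᵐ[p] fun _ => w.1 := by
    filter_upwards [hw] with b hb
    have := hb (ENNReal.ofReal_pos.2 (posteriorDensity_pos p lam _)).ne'
    simpa [sub_eq_zero, eq_comm] using this
  refine hp w.1 ?_
  rw [← Measure.map_id (μ := p), Measure.map_congr hconst, Measure.map_const]
  simp

end Dispersion

/-! ### The mean log evidence: its derivative and its limit for vanishing noise. -/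

section MeanLogEvidence

open Filter Topology

variable {E : Type*} [NormedAddCommGroup E] [InnerProductSpace ℝ E] [FiniteDimensional ℝ E]
  [MeasurableSpace E] [BorelSpace E]

/-- The mean of the logarithm of `evidence`. -/
noncomputable def meanLogEvidence (p : Measure E) (lam : ℝ) : ℝ :=
  ∫ w, Real.log (evidence p lam w) ∂p.prod (stdGaussian E)

variable {p : Measure E} [IsProbabilityMeasure p]

theorem integrable_energyBound (hp : Integrable (fun x => ‖x‖ ^ 2) p) (lam : ℝ) :
    Integrable (energyBound p lam) (p.prod (stdGaussian E)) :=
  (((hp.comp_fst (stdGaussian E)).add (integrable_const _)).const_mul _).add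
    (integrable_norm_sq_snd p)

theorem aestronglyMeasurable_log_evidence (p : Measure E) [IsProbabilityMeasure p] (lam : ℝ) :
    AEStronglyMeasurable (fun w => Real.log (evidence p lam w)) (p.prod (stdGaussian E)) :=
  (measurable_evidence p lam).log.aestronglyMeasurable

theorem integrable_log_evidence (hp : Integrable (fun x => ‖x‖ ^ 2) p) (lam : ℝ) :
    Integrable (fun w => Real.log (evidence p lam w)) (p.prod (stdGaussian E)) :=
  (integrable_energyBound hp lam).mono' (aestronglyMeasurable_log_evidence p lam)
    (ae_of_all _ fun w => abs_log_evidence_le hp lam w)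

theorem abs_posteriorSlope_le_of_mem {p : Measure E} [IsProbabilityMeasure p]
    (hp : Integrable (fun x => ‖x‖ ^ 2) p) {lam r : ℝ} (hlam : 0 < lam)
    (hr : r ∈ Ioo (lam / 2) (2 * lam)) (w : E × E) :
    |posteriorSlope p r w| ≤ (lam / 2)⁻¹ * (3 * energyBound p (2 * lam) w + ‖w.2‖ ^ 2 / 2) := by
  have hr0 : 0 < r := (half_pos hlam).trans hr.1
  have hm : 0 ≤ ∫ b, ‖b‖ ^ 2 ∂p := integral_nonneg fun _ => by positivity
  have h1 : energyBound p r w ≤ energyBound p (2 * lam) w := by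
    unfold energyBound
    have := hr.2.le
    gcongr
  have h0 : 0 ≤ energyBound p r w := by unfold energyBound; positivity
  refine (abs_posteriorSlope_le hp hr0 w).trans ?_
  have := hr.1.le
  gcongr

theorem integrable_slopeBound (hp : Integrable (fun x => ‖x‖ ^ 2) p) (lam : ℝ) :
    Integrable (fun w => (lam / 2)⁻¹ * (3 * energyBound p (2 * lam) w + ‖w.2‖ ^ 2 / 2))
      (p.prod (stdGaussian E)) :=
  (((integrable_energyBound hp _).const_mul 3).add
    ((integrable_norm_sq_snd p).div_const 2)).const_mul _

/-- The I-MMSE identity; the dispersion is twice the minimal mean squared error. -/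
theorem hasDerivAt_meanLogEvidence (hp : Integrable (fun x => ‖x‖ ^ 2) p) {lam : ℝ}
    (hlam : 0 < lam) :
    HasDerivAt (meanLogEvidence p) (-(lam / 2 * dispersion p lam)) lam := by
  rw [← integral_posteriorSlope p hlam, ← integral_neg]
  exact (hasDerivAt_integral_of_dominated_loc_of_deriv_le
    (F' := fun lam w => -posteriorSlope p lam w)
    (Ioo_mem_nhds (half_lt_self hlam) (by linarith : lam < 2 * lam))
    (Eventually.of_forall fun lam => aestronglyMeasurable_log_evidence p lam)
    (integrable_log_evidence hp lam) (measurable_posteriorSlope p lam).neg.aestronglyMeasurable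
    (ae_of_all _ fun w r hr => by
      rw [norm_neg]; exact abs_posteriorSlope_le_of_mem hp hlam hr w)
    (integrable_slopeBound hp lam)
    (ae_of_all _ fun w r _ => hasDerivAt_log_evidence hp r w)).2

theorem continuousOn_mul_dispersion (hp : Integrable (fun x => ‖x‖ ^ 2) p) :
    ContinuousOn (fun lam => lam / 2 * dispersion p lam) (Ioi 0) := by
  have h : ContinuousOn (fun lam => ∫ w, posteriorSlope p lam w ∂p.prod (stdGaussian E))
      (Ioi 0) := by
    intro lam hlam
    have hlam' : 0 < lam := hlam
    refine (continuousAt_of_dominated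
      (bound := fun w => (lam / 2)⁻¹ * (3 * energyBound p (2 * lam) w + ‖w.2‖ ^ 2 / 2))
      (Eventually.of_forall fun r => (measurable_posteriorSlope p r).aestronglyMeasurable) ?_
      (integrable_slopeBound hp lam)
      (ae_of_all _ fun w => (continuous_posteriorSlope hp w).continuousAt)).continuousWithinAt
    filter_upwards [Ioo_mem_nhds (half_lt_self hlam') (by linarith : lam < 2 * lam)] with r hr
    exact ae_of_all _ fun w => abs_posteriorSlope_le_of_mem hp hlam' hr w
  exact h.congr fun lam hlam => (integral_posteriorSlope p hlam).symm

/-- Only `b = a` is kept. The bound is free of `lam` and dominates the log evidence in the limit of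
vanishing noise. -/
theorem measureReal_singleton_mul_exp_le_evidence (p : Measure E) [IsProbabilityMeasure p]
    (lam : ℝ) (w : E × E) :
    p.real {w.1} * Real.exp (-(‖w.2‖ ^ 2 / 2)) ≤ evidence p lam w := by
  have h1 := setIntegral_le_integral (s := {w.1}) (integrable_exp_neg_energy p lam w)
    (ae_of_all _ fun b => (Real.exp_pos _).le)
  rwa [integral_singleton, smul_eq_mul, energy, noiseTo_self] at h1

/-- The energy of every `b ≠ a` tends to infinity, so only the atom at `a` survives. -/
theorem tendsto_evidence (p : Measure E) [IsProbabilityMeasure p] (w : E × E) :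
    Tendsto (fun lam => evidence p lam w) atTop
      (𝓝 (p.real {w.1} * Real.exp (-(‖w.2‖ ^ 2 / 2)))) := by
  have e : p.real {w.1} * Real.exp (-(‖w.2‖ ^ 2 / 2)) =
      ∫ b, ({w.1} : Set E).indicator (fun _ => Real.exp (-(‖w.2‖ ^ 2 / 2))) b ∂p := by
    rw [integral_indicator_const _ (measurableSet_singleton _), smul_eq_mul]
  rw [e]
  refine tendsto_integral_filter_of_dominated_convergence (fun _ => 1)
    (Eventually.of_forall fun lam => (integrable_exp_neg_energy p lam w).1)
    (Eventually.of_forall fun lam => ae_of_all _ fun b => ?_) (integrable_const _)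
    (ae_of_all _ fun b => ?_)
  · rw [Real.norm_eq_abs, Real.abs_exp]
    exact Real.exp_le_one_iff.2 (neg_nonpos.2 (energy_nonneg _ _ _))
  · by_cases hb : b = w.1
    · subst hb
      simp only [mem_singleton_iff, indicator_of_mem, energy, noiseTo_self]
      exact tendsto_const_nhds
    · rw [indicator_of_notMem (by simpa using hb)]
      refine Real.tendsto_exp_atBot.comp (tendsto_neg_atTop_atBot.comp ?_)
      have hpos : 0 < ‖w.1 - b‖ := norm_pos_iff.2 (sub_ne_zero.2 (Ne.symm hb))
      have h1 : Tendsto (fun lam => lam * ‖w.1 - b‖ - ‖w.2‖) atTop atTop :=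
        tendsto_atTop_add_const_right _ _ (tendsto_id.atTop_mul_const hpos)
      have h2 : Tendsto (fun lam => ‖noiseTo lam w b‖) atTop atTop := by
        refine tendsto_atTop_mono' _ ?_ h1
        filter_upwards [eventually_ge_atTop 0] with lam hlam
        have h := norm_sub_norm_le (lam • (w.1 - b)) (-w.2)
        rwa [sub_neg_eq_add, norm_neg, norm_smul, Real.norm_of_nonneg hlam] at h
      exact ((tendsto_pow_atTop two_ne_zero).comp h2).atTop_div_const two_pos

/-- For discrete data, the observation determines the datum in the limit of vanishing noise. -/
theorem tendsto_meanLogEvidence (hatom : ∀ᵐ a ∂p, p {a} ≠ 0)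
    (hent : Integrable (fun a => Real.log (p.real {a})) p) :
    Tendsto (meanLogEvidence p) atTop
      (𝓝 (∫ w, (Real.log (p.real {w.1}) - ‖w.2‖ ^ 2 / 2) ∂p.prod (stdGaussian E))) := by
  have hatom' : ∀ᵐ w ∂p.prod (stdGaussian E), 0 < p.real {w.1} := by
    have h := Measure.quasiMeasurePreserving_fst (μ := p) (ν := stdGaussian E) |>.ae hatom
    filter_upwards [h] with w hw
    exact ENNReal.toReal_pos hw (measure_ne_top _ _)
  refine tendsto_integral_filter_of_dominated_convergence
    (fun w => |Real.log (p.real {w.1})| + ‖w.2‖ ^ 2 / 2)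
    (Eventually.of_forall fun lam => aestronglyMeasurable_log_evidence p lam)
    (Eventually.of_forall fun lam => ?_)
    ((hent.comp_fst (stdGaussian E)).abs.add ((integrable_norm_sq_snd p).div_const 2)) ?_
  · filter_upwards [hatom'] with w hw
    rw [Real.norm_eq_abs, abs_of_nonpos (log_evidence_nonpos p lam w)]
    have h := Real.log_le_log (by positivity) (measureReal_singleton_mul_exp_le_evidence p lam w)
    rw [Real.log_mul hw.ne' (Real.exp_ne_zero _), Real.log_exp] at h
    have := neg_abs_le (Real.log (p.real {w.1}))
    linarith
  · filter_upwards [hatom'] with w hw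
    have h := (tendsto_evidence p w).log (by positivity)
    rwa [Real.log_mul hw.ne' (Real.exp_ne_zero _), Real.log_exp, ← sub_eq_add_neg] at h

end MeanLogEvidence

/-! ### The conditional density for a Gaussian channel. -/

section GaussianChannel

open Filter Topology

variable {E : Type*} [NormedAddCommGroup E] [InnerProductSpace ℝ E] [FiniteDimensional ℝ E]
  [MeasurableSpace E] [BorelSpace E]

/-- The observation `s (a + r z)` of the datum `a` with the noise `z`. -/
def observation (s r : ℝ) (w : E × E) : E := s • (w.1 + r • w.2)

theorem measurable_observation (s r : ℝ) : Measurable (observation (E := E) s r) := by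
  unfold observation; fun_prop

omit [FiniteDimensional ℝ E] [MeasurableSpace E] [BorelSpace E] in
-- The pair `(0, x / (r s))` produces the same value `λ a + z` as `w`, so it stands in for `w` when
-- the posterior is to be a function of the observation alone.
theorem noiseTo_observation {s r : ℝ} (hs : s ≠ 0) (hr : r ≠ 0) (w : E × E) (b : E) :
    noiseTo r⁻¹ (0, (r⁻¹ * s⁻¹) • observation s r w) b = noiseTo r⁻¹ w b := by
  simp only [noiseTo, observation]
  rw [smul_smul, inv_mul_cancel_right₀ hs, smul_add, inv_smul_smul₀ hr, zero_sub, smul_neg,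
    smul_sub]
  abel

omit [FiniteDimensional ℝ E] [BorelSpace E] in
theorem posteriorDensity_observation (p : Measure E) {s r : ℝ} (hs : s ≠ 0) (hr : r ≠ 0)
    (w : E × E) (b : E) :
    posteriorDensity p r⁻¹ ((0, (r⁻¹ * s⁻¹) • observation s r w), b) =
      posteriorDensity p r⁻¹ (w, b) := by
  simp only [posteriorDensity, evidence, energy, noiseTo_observation hs hr]

omit [FiniteDimensional ℝ E] [MeasurableSpace E] [BorelSpace E] in
theorem observation_exchangeData (s : ℝ) {r : ℝ} (hr : r ≠ 0) (q : (E × E) × E) :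
    observation s r (exchangeData r⁻¹ q).1 = observation s r q.1 := by
  simp only [observation, exchangeData, noiseTo]
  rw [smul_add r, smul_inv_smul₀ hr]
  congr 1
  abel

omit [FiniteDimensional ℝ E] [BorelSpace E] in
theorem posteriorDensity_self (p : Measure E) (lam : ℝ) (w : E × E) :
    posteriorDensity p lam (w, w.1) = Real.exp (-(‖w.2‖ ^ 2 / 2)) / evidence p lam w := by
  simp only [posteriorDensity, energy, noiseTo_self]

theorem measurable_ofReal_posteriorDensity_observation (p : Measure E) [IsProbabilityMeasure p]
    (s r : ℝ) : Measurable fun y : E × E =>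
      ENNReal.ofReal (posteriorDensity p r⁻¹ ((0, (r⁻¹ * s⁻¹) • y.2), y.1)) :=
  (measurable_posteriorDensity p r⁻¹).ennreal_ofReal.comp
    (by fun_prop : Measurable fun y : E × E => (((0 : E), (r⁻¹ * s⁻¹) • y.2), y.1))

variable {p : Measure E} [IsProbabilityMeasure p] {κ : Kernel E E} [IsMarkovKernel κ] {s r : ℝ}

theorem compProd_eq_map_observation
    (hκ : ∀ a, κ a = (stdGaussian E).map fun z => s • (a + r • z)) :
    p ⊗ₘ κ = (p.prod (stdGaussian E)).map fun w => (w.1, observation s r w) := by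
  have hX : Measurable fun w : E × E => (w.1, observation s r w) :=
    measurable_fst.prodMk (measurable_observation s r)
  refine Measure.ext_of_lintegral _ fun f hf => ?_
  rw [Measure.lintegral_compProd hf, lintegral_map hf hX,
    lintegral_prod (fun w => f (w.1, observation s r w)) (hf.comp hX).aemeasurable]
  refine lintegral_congr fun a => ?_
  have hfa : Measurable fun x => f (a, x) := hf.comp measurable_prodMk_left
  rw [hκ a, lintegral_map hfa (by fun_prop)]
  rfl

theorem comp_eq_map_observation
    (hκ : ∀ a, κ a = (stdGaussian E).map fun z => s • (a + r • z)) :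
    κ ∘ₘ p = (p.prod (stdGaussian E)).map (observation s r) := by
  rw [← Measure.snd_compProd, compProd_eq_map_observation hκ, Measure.snd,
    Measure.map_map measurable_snd (measurable_fst.prodMk (measurable_observation s r))]
  rfl

/-- Bayes' formula. -/
theorem compProd_eq_withDensity (hs : s ≠ 0) (hr : r ≠ 0)
    (hκ : ∀ a, κ a = (stdGaussian E).map fun z => s • (a + r • z)) :
    p ⊗ₘ κ = (p.prod (κ ∘ₘ p)).withDensity fun y =>
      ENNReal.ofReal (posteriorDensity p r⁻¹ ((0, (r⁻¹ * s⁻¹) • y.2), y.1)) := by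
  have hX := measurable_observation (E := E) s r
  have hpost := (measurable_posteriorDensity p r⁻¹).ennreal_ofReal
  have hpost' := measurable_ofReal_posteriorDensity_observation p s r
  refine Measure.ext_of_lintegral _ fun f hf => ?_
  have hf₁ : Measurable fun w : E × E => f (w.1, observation s r w) :=
    hf.comp (measurable_fst.prodMk hX)
  have hf₂ : Measurable fun q : (E × E) × E => f (q.2, observation s r q.1) :=
    hf.comp (measurable_snd.prodMk (hX.comp measurable_fst))
  -- The datum is exchanged with its replica, which fixes the observation; the replica has the
  -- posterior density by construction.
  have hL : ∫⁻ y, f y ∂(p ⊗ₘ κ) =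
      ∫⁻ w, ∫⁻ a, ENNReal.ofReal (posteriorDensity p r⁻¹ (w, a)) * f (a, observation s r w) ∂p
        ∂p.prod (stdGaussian E) := by
    calc ∫⁻ y, f y ∂(p ⊗ₘ κ)
        = ∫⁻ w, f (w.1, observation s r w) ∂p.prod (stdGaussian E) := by
          rw [compProd_eq_map_observation hκ, lintegral_map hf (measurable_fst.prodMk hX)]
      _ = ∫⁻ q, f (q.1.1, observation s r q.1) ∂replicaLaw p r⁻¹ := by
          rw [← map_fst_replicaLaw p r⁻¹, lintegral_map hf₁ measurable_fst]
      _ = ∫⁻ q, f (q.2, observation s r q.1) ∂replicaLaw p r⁻¹ := by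
          conv_rhs => rw [← (measurePreserving_exchangeData p r⁻¹).map_eq]
          rw [lintegral_map hf₂ (measurable_exchangeData _)]
          simp only [observation_exchangeData s hr]
          rfl
      _ = _ := by
          rw [replicaLaw, lintegral_withDensity_eq_lintegral_mul _ hpost hf₂,
            lintegral_prod _ (hpost.mul hf₂).aemeasurable]
          rfl
  have hg' : Measurable fun x : E => ∫⁻ a,
      ENNReal.ofReal (posteriorDensity p r⁻¹ ((0, (r⁻¹ * s⁻¹) • x), a)) * f (a, x) ∂p :=
    (hpost'.mul hf).lintegral_prod_left'
  rw [hL, lintegral_withDensity_eq_lintegral_mul _ hpost' hf,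
    lintegral_prod_symm' _ (hpost'.mul hf)]
  simp only [Pi.mul_apply]
  rw [comp_eq_map_observation hκ, lintegral_map hg' hX]
  simp_rw [posteriorDensity_observation p hs hr]

variable {ν : Measure E} [SigmaFinite ν]

/-- The density is `p.rnDeriv ν` at the datum times the posterior density, whose energy at the true
datum is `‖z‖ ^ 2 / 2`. Only the evidence depends on the noise level. -/
theorem ae_log_rnDeriv_compProd_eq (hs : s ≠ 0) (hr : r ≠ 0) (hpν : p ≪ ν)
    (hκ : ∀ a, κ a = (stdGaussian E).map fun z => s • (a + r • z)) :
    ∀ᵐ w ∂p.prod (stdGaussian E),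
      Real.log ((p ⊗ₘ κ).rnDeriv (ν.prod (κ ∘ₘ p)) (w.1, observation s r w)).toReal =
        Real.log (p.rnDeriv ν w.1).toReal - ‖w.2‖ ^ 2 / 2
          - Real.log (evidence p r⁻¹ w) := by
  have hpost := measurable_ofReal_posteriorDensity_observation p s r
  have hρ : Measurable fun y : E × E => p.rnDeriv ν y.1 :=
    (Measure.measurable_rnDeriv p ν).comp measurable_fst
  have hbayes : p ⊗ₘ κ = (ν.prod (κ ∘ₘ p)).withDensity ((fun y => p.rnDeriv ν y.1) *
      fun y => ENNReal.ofReal (posteriorDensity p r⁻¹ ((0, (r⁻¹ * s⁻¹) • y.2), y.1))) := by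
    rw [withDensity_mul _ hρ hpost, ← prod_withDensity_left (Measure.measurable_rnDeriv p ν),
      Measure.withDensity_rnDeriv_eq p ν hpν, ← compProd_eq_withDensity hs hr hκ]
  have h1 : (p ⊗ₘ κ).rnDeriv (ν.prod (κ ∘ₘ p)) =ᵐ[p ⊗ₘ κ] (fun y => p.rnDeriv ν y.1) *
      fun y => ENNReal.ofReal (posteriorDensity p r⁻¹ ((0, (r⁻¹ * s⁻¹) • y.2), y.1)) := by
    have hac : p ⊗ₘ κ ≪ ν.prod (κ ∘ₘ p) := by
      rw [hbayes]; exact withDensity_absolutelyContinuous _ _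
    refine hac.ae_le ?_
    have := Measure.rnDeriv_withDensity (ν.prod (κ ∘ₘ p)) (hρ.mul hpost)
    rwa [← hbayes] at this
  have hmap : ae (p ⊗ₘ κ) =
      ae ((p.prod (stdGaussian E)).map fun w => (w.1, observation s r w)) := by
    rw [compProd_eq_map_observation hκ]
  rw [Filter.EventuallyEq, hmap] at h1
  have h2 := ae_of_ae_map (measurable_fst.prodMk (measurable_observation s r)).aemeasurable h1
  have h3 : ∀ᵐ w ∂p.prod (stdGaussian E), 0 < p.rnDeriv ν w.1 :=
    Measure.quasiMeasurePreserving_fst.ae (Measure.rnDeriv_pos hpν)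
  have h4 : ∀ᵐ w ∂p.prod (stdGaussian E), p.rnDeriv ν w.1 < ⊤ :=
    Measure.quasiMeasurePreserving_fst.ae (hpν.ae_le (Measure.rnDeriv_lt_top p ν))
  filter_upwards [h2, h3, h4] with w hw hpos htop
  have hev := evidence_pos p r⁻¹ w
  rw [hw, Pi.mul_apply, posteriorDensity_observation p hs hr, posteriorDensity_self,
    ENNReal.toReal_mul, ENNReal.toReal_ofReal (by positivity),
    Real.log_mul (ENNReal.toReal_pos hpos.ne' htop.ne).ne' (by positivity),
    Real.log_div (Real.exp_ne_zero _) hev.ne', Real.log_exp]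
  ring

theorem integrable_log_rnDeriv_compProd (hs : s ≠ 0) (hr : r ≠ 0) (hpν : p ≪ ν)
    (hp : Integrable (fun x => ‖x‖ ^ 2) p)
    (hent : Integrable (fun x => Real.log (p.rnDeriv ν x).toReal) p)
    (hκ : ∀ a, κ a = (stdGaussian E).map fun z => s • (a + r • z)) :
    Integrable (fun y => Real.log ((p ⊗ₘ κ).rnDeriv (ν.prod (κ ∘ₘ p)) y).toReal) (p ⊗ₘ κ) := by
  have hX := measurable_fst.prodMk (measurable_observation (E := E) s r)
  have h : Integrable (fun w => Real.log
      ((p ⊗ₘ κ).rnDeriv (ν.prod (κ ∘ₘ p)) (w.1, observation s r w)).toReal)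
      (p.prod (stdGaussian E)) := by
    refine (((hent.comp_fst (stdGaussian E)).sub ((integrable_norm_sq_snd p).div_const 2)).sub
      (integrable_log_evidence hp r⁻¹)).congr ?_
    filter_upwards [ae_log_rnDeriv_compProd_eq hs hr hpν hκ] with w hw
    exact hw.symm
  nth_rewrite 2 [compProd_eq_map_observation hκ]
  exact (integrable_map_measure
    (Measure.measurable_rnDeriv _ _).ennreal_toReal.log.aestronglyMeasurable hX.aemeasurable).2 h

theorem integral_log_rnDeriv_compProd (hs : s ≠ 0) (hr : r ≠ 0) (hpν : p ≪ ν)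
    (hp : Integrable (fun x => ‖x‖ ^ 2) p)
    (hent : Integrable (fun x => Real.log (p.rnDeriv ν x).toReal) p)
    (hκ : ∀ a, κ a = (stdGaussian E).map fun z => s • (a + r • z)) :
    ∫ y, Real.log ((p ⊗ₘ κ).rnDeriv (ν.prod (κ ∘ₘ p)) y).toReal ∂(p ⊗ₘ κ) =
      ∫ w, (Real.log (p.rnDeriv ν w.1).toReal - ‖w.2‖ ^ 2 / 2) ∂p.prod (stdGaussian E)
        - meanLogEvidence p r⁻¹ := by
  have hX := measurable_fst.prodMk (measurable_observation (E := E) s r)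
  nth_rewrite 1 [compProd_eq_map_observation hκ]
  rw [integral_map hX.aemeasurable
    (Measure.measurable_rnDeriv _ _).ennreal_toReal.log.aestronglyMeasurable,
    integral_congr_ae (ae_log_rnDeriv_compProd_eq hs hr hpν hκ),
    integral_sub (f := fun w => Real.log (p.rnDeriv ν w.1).toReal - ‖w.2‖ ^ 2 / 2)
      ((hent.comp_fst (stdGaussian E)).sub ((integrable_norm_sq_snd p).div_const 2))
      (integrable_log_evidence hp r⁻¹), meanLogEvidence]

end GaussianChannel

/-! ### Discrete data observed without noise. -/

section DiscreteData

variable {E : Type*} [MeasurableSpace E] [MeasurableSingletonClass E] {p : Measure E}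
  [IsProbabilityMeasure p] {S : Set E}

omit [IsProbabilityMeasure p] in
theorem ae_count_restrict_singleton (hS : S.Countable) (hpν : p ≪ Measure.count.restrict S) :
    ∀ᵐ a ∂p, Measure.count.restrict S {a} = 1 := by
  filter_upwards [hpν.ae_le (ae_restrict_mem hS.measurableSet)] with a ha
  rw [Measure.restrict_apply (measurableSet_singleton a),
    inter_eq_left.2 (singleton_subset_iff.2 ha), Measure.count_singleton]

theorem ae_rnDeriv_count_eq [SigmaFinite (Measure.count.restrict S)] (hS : S.Countable)
    (hpν : p ≪ Measure.count.restrict S) :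
    ∀ᵐ a ∂p, p.rnDeriv (Measure.count.restrict S) a = p {a} := by
  filter_upwards [ae_count_restrict_singleton hS hpν] with a ha
  conv_rhs => rw [← Measure.withDensity_rnDeriv_eq p _ hpν]
  rw [withDensity_apply _ (measurableSet_singleton a), lintegral_singleton, ha, mul_one]

variable [MeasurableEq E] {κ : Kernel E E}

/-- The joint law lives on the diagonal, and its density is the indicator of the diagonal because
atoms have counting measure one. -/
theorem ae_rnDeriv_compProd_dirac_eq_one [IsMarkovKernel κ] [SigmaFinite (Measure.count.restrict S)]
    (hS : S.Countable) (hpν : p ≪ Measure.count.restrict S) (hκ : ∀ a, κ a = Measure.dirac a) :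
    ∀ᵐ y ∂(p ⊗ₘ κ), (p ⊗ₘ κ).rnDeriv ((Measure.count.restrict S).prod (κ ∘ₘ p)) y = 1 := by
  have hjoint : p ⊗ₘ κ = p.map fun a => (a, a) := by
    refine Measure.ext_of_lintegral _ fun f hf => ?_
    rw [Measure.lintegral_compProd hf, lintegral_map hf (by fun_prop)]
    refine lintegral_congr fun a => ?_
    rw [hκ a, lintegral_dirac]
  have hmarg : κ ∘ₘ p = p := by
    rw [← Measure.snd_compProd, hjoint, Measure.snd, Measure.map_map measurable_snd (by fun_prop)]
    exact Measure.map_id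
  have hdiag : Measurable ((diagonal E).indicator fun _ => (1 : ℝ≥0∞)) :=
    measurable_const.indicator measurableSet_diagonal
  have hdens : p ⊗ₘ κ = ((Measure.count.restrict S).prod (κ ∘ₘ p)).withDensity
      ((diagonal E).indicator fun _ => 1) := by
    rw [hmarg, hjoint]
    refine Measure.ext_of_lintegral _ fun f hf => ?_
    rw [lintegral_map hf (by fun_prop), lintegral_withDensity_eq_lintegral_mul _ hdiag hf,
      lintegral_prod_symm' _ (hdiag.mul hf)]
    refine lintegral_congr_ae ?_
    filter_upwards [ae_count_restrict_singleton hS hpν] with x hx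
    have e : ∀ a, ((diagonal E).indicator (fun _ => (1 : ℝ≥0∞)) * f) (a, x) =
        ({x} : Set E).indicator (fun a => f (a, x)) a := by
      intro a
      by_cases ha : a = x <;> simp [ha]
    simp_rw [e]
    rw [lintegral_indicator (measurableSet_singleton x), lintegral_singleton, hx, mul_one]
  have h1 : (p ⊗ₘ κ).rnDeriv ((Measure.count.restrict S).prod (κ ∘ₘ p)) =ᵐ[p ⊗ₘ κ]
      (diagonal E).indicator fun _ => 1 := by
    have hac : p ⊗ₘ κ ≪ (Measure.count.restrict S).prod (κ ∘ₘ p) := by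
      rw [hdens]; exact withDensity_absolutelyContinuous _ _
    refine hac.ae_le ?_
    have := Measure.rnDeriv_withDensity ((Measure.count.restrict S).prod (κ ∘ₘ p)) hdiag
    rwa [← hdens] at this
  have h2 : ∀ᵐ y ∂(p ⊗ₘ κ), y ∈ diagonal E := by
    rw [hjoint, ae_map_iff (p := (· ∈ diagonal E)) (by fun_prop) measurableSet_diagonal]
    exact ae_of_all _ fun a => rfl
  filter_upwards [h1, h2] with y hy hy'
  rw [hy, indicator_of_mem hy']

end DiscreteData

/-! ### Primitives and monotonicity up to the endpoint 0. -/

section RealFunctions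

open Filter Topology

/-- Extending `Q` by zero keeps it bounded and measurable, so its primitive is continuous through 0
even if `Q` has no limit there. -/
theorem exists_primitive_of_bounded {Q : ℝ → ℝ} {B : ℝ} (hQ : ContinuousOn Q (Ioi 0))
    (hB : ∀ u, 0 < u → |Q u| ≤ B) :
    ∃ Φ : ℝ → ℝ, Continuous Φ ∧ ∀ u, 0 < u → HasDerivAt Φ (Q u) u := by
  have hB0 : 0 ≤ B := (abs_nonneg _).trans (hB 1 one_pos)
  have hm : AEStronglyMeasurable ((Ioi 0).indicator Q) := by
    rw [aestronglyMeasurable_indicator_iff measurableSet_Ioi]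
    exact hQ.aestronglyMeasurable measurableSet_Ioi
  have hint : ∀ a b, IntervalIntegrable ((Ioi 0).indicator Q) volume a b := fun a b =>
    (intervalIntegrable_const (c := B)).mono_fun' hm.restrict (ae_of_all _ fun u => by
      change ‖(Ioi 0).indicator Q u‖ ≤ B
      by_cases hu : u ∈ Ioi (0 : ℝ)
      · rw [indicator_of_mem hu]; exact hB u hu
      · rw [indicator_of_notMem hu, norm_zero]; exact hB0)
  refine ⟨fun u => ∫ x in (0 : ℝ)..u, (Ioi 0).indicator Q x,
    intervalIntegral.continuous_primitive hint 0, fun u hu => ?_⟩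
  have hc : ContinuousOn ((Ioi 0).indicator Q) (Ioi 0) :=
    hQ.congr fun u hu => indicator_of_mem hu Q
  have h := intervalIntegral.integral_hasDerivAt_right (hint 0 u)
    (hc.stronglyMeasurableAtFilter isOpen_Ioi u hu) (hc.continuousAt (Ioi_mem_nhds hu))
  rwa [indicator_of_mem (show u ∈ Ioi (0 : ℝ) from hu)] at h

variable {I : Set ℝ} {φ : ℝ → ℝ}

theorem monotoneOn_of_inter_Ioi (hI : Convex ℝ I) (hI_zero : 0 ∈ I) (hI_nonneg : ∀ t ∈ I, 0 ≤ t)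
    (hc : ContinuousOn φ I) (hm : MonotoneOn φ (I ∩ Ioi 0)) : MonotoneOn φ I := by
  intro a ha b hb hab
  rcases (hI_nonneg a ha).eq_or_lt with rfl | ha0
  · rcases hab.eq_or_lt with rfl | hb0
    · rfl
    have hsub := (Ioo_subset_Icc_self).trans (hI.Icc_zero_subset hI_zero hb)
    have h := (hc 0 hI_zero).mono hsub
    have : (𝓝[Ioo 0 b] (0 : ℝ)).NeBot := left_nhdsWithin_Ioo_neBot hb0
    refine le_of_tendsto h.tendsto ?_
    filter_upwards [self_mem_nhdsWithin] with x hx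
    exact hm ⟨hsub hx, hx.1⟩ ⟨hb, hb0⟩ hx.2.le
  · exact hm ⟨ha, ha0⟩ ⟨hb, ha0.trans_le hab⟩ hab

theorem strictMonoOn_of_inter_Ioi (hI : Convex ℝ I) (hI_zero : 0 ∈ I)
    (hI_nonneg : ∀ t ∈ I, 0 ≤ t) (hc : ContinuousOn φ I) (hm : StrictMonoOn φ (I ∩ Ioi 0)) :
    StrictMonoOn φ I := by
  intro a ha b hb hab
  have ha0 := hI_nonneg a ha
  -- The midpoint is positive even for `a = 0`, so strictness is needed only at positive times.
  have hc' : (a + b) / 2 ∈ I :=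
    hI.Icc_zero_subset hI_zero hb ⟨by linarith, by linarith⟩
  have hb0 : 0 < b := ha0.trans_lt hab
  calc φ a ≤ φ ((a + b) / 2) :=
        monotoneOn_of_inter_Ioi hI hI_zero hI_nonneg hc hm.monotoneOn ha hc' (by linarith)
    _ < φ b := hm ⟨hc', show 0 < (a + b) / 2 by linarith⟩ ⟨hb, hb0⟩ (by linarith)

end RealFunctions

/-! ### The entropy as a function of the noise level. -/

section EntropyOfNoiseLevel

variable {E : Type*} [NormedAddCommGroup E] [InnerProductSpace ℝ E] [FiniteDimensional ℝ E]
  [MeasurableSpace E] [BorelSpace E]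

/-- The derivative of the rescaled entropy with respect to the noise level. -/
noncomputable def rescaledEntropyRate (p : Measure E) (u : ℝ) : ℝ :=
  u⁻¹ ^ 2 * dispersion p u⁻¹ / 2

omit [BorelSpace E] in
theorem rescaledEntropyRate_nonneg (p : Measure E) (u : ℝ) : 0 ≤ rescaledEntropyRate p u := by
  have := dispersion_nonneg p u⁻¹
  unfold rescaledEntropyRate
  positivity

variable {p : Measure E} [IsProbabilityMeasure p]

theorem rescaledEntropyRate_pos (hp : ∀ a, p ≠ Measure.dirac a) {u : ℝ} (hu : 0 < u) :
    0 < rescaledEntropyRate p u := by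
  have := dispersion_pos p (inv_pos.2 hu) hp
  unfold rescaledEntropyRate
  positivity

theorem abs_rescaledEntropyRate_le (p : Measure E) [IsProbabilityMeasure p] (u : ℝ) :
    |rescaledEntropyRate p u| ≤ 2 * stdGaussianMoment E := by
  rw [abs_of_nonneg (rescaledEntropyRate_nonneg p u), rescaledEntropyRate]
  linarith [sq_mul_dispersion_le p u⁻¹]

theorem continuousOn_rescaledEntropyRate (hp : Integrable (fun x => ‖x‖ ^ 2) p) :
    ContinuousOn (rescaledEntropyRate p) (Ioi 0) := by
  have hinv : ContinuousOn (fun u : ℝ => u⁻¹) (Ioi 0) :=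
    continuousOn_inv₀.mono fun u hu => (ne_of_gt hu : u ≠ 0)
  refine (hinv.mul ((continuousOn_mul_dispersion hp).comp hinv fun u hu =>
    mem_Ioi.2 (inv_pos.2 (mem_Ioi.1 hu)))).congr fun u _ => ?_
  simp only [rescaledEntropyRate, Pi.mul_apply, Function.comp_apply]
  ring

theorem hasDerivAt_meanLogEvidence_inv (hp : Integrable (fun x => ‖x‖ ^ 2) p) {u : ℝ}
    (hu : 0 < u) :
    HasDerivAt (fun u => meanLogEvidence p u⁻¹) (u⁻¹ * rescaledEntropyRate p u) u := by
  refine ((hasDerivAt_meanLogEvidence hp (inv_pos.2 hu)).comp u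
    (hasDerivAt_inv hu.ne')).congr_deriv ?_
  rw [rescaledEntropyRate]
  field_simp

theorem monotoneOn_meanLogEvidence_inv (hp : Integrable (fun x => ‖x‖ ^ 2) p) :
    MonotoneOn (fun u => meanLogEvidence p u⁻¹) (Ioi 0) := by
  refine monotoneOn_of_hasDerivWithinAt_nonneg (convex_Ioi 0)
    (f' := fun u => u⁻¹ * rescaledEntropyRate p u)
    (fun u hu => (hasDerivAt_meanLogEvidence_inv hp hu).continuousAt.continuousWithinAt)
    (fun u hu => ?_) fun u hu => ?_
  all_goals rw [interior_Ioi] at hu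
  · exact (hasDerivAt_meanLogEvidence_inv hp hu).hasDerivWithinAt
  · exact mul_nonneg (inv_pos.2 hu).le (rescaledEntropyRate_nonneg p u)

theorem strictMonoOn_meanLogEvidence_inv (hp : Integrable (fun x => ‖x‖ ^ 2) p)
    (hp' : ∀ a, p ≠ Measure.dirac a) :
    StrictMonoOn (fun u => meanLogEvidence p u⁻¹) (Ioi 0) := by
  refine strictMonoOn_of_deriv_pos (convex_Ioi 0)
    (fun u hu => (hasDerivAt_meanLogEvidence_inv hp hu).continuousAt.continuousWithinAt)
    fun u hu => ?_
  rw [interior_Ioi] at hu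
  rw [(hasDerivAt_meanLogEvidence_inv hp hu).deriv]
  exact mul_pos (inv_pos.2 hu) (rescaledEntropyRate_pos hp' hu)

end EntropyOfNoiseLevel

/-! ### The conditional entropy and the rescaled entropy at positive times. -/

section ConditionalEntropy

open Filter Topology

variable {d : ℕ} {I : Set ℝ} {s σ : ℝ → ℝ}
  {K : ℝ → Kernel (EuclideanSpace ℝ (Fin d)) (EuclideanSpace ℝ (Fin d))}
  {ν p₀ : Measure (EuclideanSpace ℝ (Fin d))} [SigmaFinite ν] [IsProbabilityMeasure p₀]

theorem integrable_log_denoisingDensity (hI : Convex ℝ I) (hI_zero : 0 ∈ I)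
    (hI_nonneg : ∀ t ∈ I, 0 ≤ t) (hsσ : IsNoiseSchedule I s σ)
    (hK : IsForwardKernel I (edmDrift s) (edmVolatility s σ) K) (hp₀ν : p₀ ≪ ν)
    (hp₀_moment : Integrable (fun x => ‖x‖ ^ 2) p₀)
    (hp₀_entropy : Integrable (fun x => Real.log (p₀.rnDeriv ν x).toReal) p₀)
    {t : ℝ} (ht : t ∈ I) (ht0 : 0 < t) :
    Integrable (fun z => Real.log (denoisingDensity ν p₀ (K t) z).toReal) (p₀ ⊗ₘ K t) := by
  have := hK.markov t ht
  exact integrable_log_rnDeriv_compProd (hsσ.s_pos t ht).ne' (hsσ.σ_pos hI_zero ht ht0).ne' hp₀ν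
    hp₀_moment hp₀_entropy (hK.apply_eq_map hI hI_zero hI_nonneg hsσ ht)

theorem condEntropy_eq (hI : Convex ℝ I) (hI_zero : 0 ∈ I)
    (hI_nonneg : ∀ t ∈ I, 0 ≤ t) (hsσ : IsNoiseSchedule I s σ)
    (hK : IsForwardKernel I (edmDrift s) (edmVolatility s σ) K) (hp₀ν : p₀ ≪ ν)
    (hp₀_moment : Integrable (fun x => ‖x‖ ^ 2) p₀)
    (hp₀_entropy : Integrable (fun x => Real.log (p₀.rnDeriv ν x).toReal) p₀)
    {t : ℝ} (ht : t ∈ I) (ht0 : 0 < t) :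
    condEntropy ν p₀ (K t) = meanLogEvidence p₀ (σ t)⁻¹
      - ∫ w, (Real.log (p₀.rnDeriv ν w.1).toReal - ‖w.2‖ ^ 2 / 2)
        ∂p₀.prod (stdGaussian (EuclideanSpace ℝ (Fin d))) := by
  have := hK.markov t ht
  have h := integral_log_rnDeriv_compProd (hsσ.s_pos t ht).ne' (hsσ.σ_pos hI_zero ht ht0).ne' hp₀ν
    hp₀_moment hp₀_entropy (hK.apply_eq_map hI hI_zero hI_nonneg hsσ ht)
  rw [condEntropy]
  simp only [denoisingDensity]
  rw [h]
  ring

theorem hasDerivAt_condEntropy (hI : Convex ℝ I) (hI_zero : 0 ∈ I)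
    (hI_nonneg : ∀ t ∈ I, 0 ≤ t) (hsσ : IsNoiseSchedule I s σ)
    (hK : IsForwardKernel I (edmDrift s) (edmVolatility s σ) K) (hp₀ν : p₀ ≪ ν)
    (hp₀_moment : Integrable (fun x => ‖x‖ ^ 2) p₀)
    (hp₀_entropy : Integrable (fun x => Real.log (p₀.rnDeriv ν x).toReal) p₀)
    {t : ℝ} (ht : t ∈ interior I) :
    HasDerivAt (fun t => condEntropy ν p₀ (K t))
      ((σ t)⁻¹ * rescaledEntropyRate p₀ (σ t) * deriv σ t) t := by
  have ht0 := pos_of_mem_interior hI_nonneg ht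
  have hσ0 := hsσ.σ_pos hI_zero (interior_subset ht) ht0
  have h := ((hasDerivAt_meanLogEvidence_inv hp₀_moment hσ0).comp t
    (hsσ.hasDerivAt_σ ht)).sub_const (∫ w, (Real.log (p₀.rnDeriv ν w.1).toReal - ‖w.2‖ ^ 2 / 2)
        ∂p₀.prod (stdGaussian (EuclideanSpace ℝ (Fin d))))
  refine h.congr_of_eventuallyEq ?_
  filter_upwards [isOpen_interior.mem_nhds ht] with r hr
  exact condEntropy_eq hI hI_zero hI_nonneg hsσ hK hp₀ν hp₀_moment hp₀_entropy
    (interior_subset hr) (pos_of_mem_interior hI_nonneg hr)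

theorem continuousOn_condEntropy (hI : Convex ℝ I) (hI_zero : 0 ∈ I)
    (hI_nonneg : ∀ t ∈ I, 0 ≤ t) (hsσ : IsNoiseSchedule I s σ)
    (hK : IsForwardKernel I (edmDrift s) (edmVolatility s σ) K) (hp₀ν : p₀ ≪ ν)
    (hp₀_moment : Integrable (fun x => ‖x‖ ^ 2) p₀)
    (hp₀_entropy : Integrable (fun x => Real.log (p₀.rnDeriv ν x).toReal) p₀) :
    ContinuousOn (fun t => condEntropy ν p₀ (K t)) (I ∩ Ioi 0) := by
  have hc : ContinuousOn (fun u => meanLogEvidence p₀ u⁻¹) (Ioi 0) := fun u hu =>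
    (hasDerivAt_meanLogEvidence_inv hp₀_moment hu).continuousAt.continuousWithinAt
  have h := (hc.comp (hsσ.σ_continuousOn.mono inter_subset_left) fun t ht =>
    hsσ.σ_pos hI_zero ht.1 ht.2).sub (continuousOn_const (c := ∫ w,
      (Real.log (p₀.rnDeriv ν w.1).toReal - ‖w.2‖ ^ 2 / 2)
        ∂p₀.prod (stdGaussian (EuclideanSpace ℝ (Fin d)))))
  exact h.congr fun t ht => condEntropy_eq hI hI_zero hI_nonneg hsσ hK hp₀ν hp₀_moment
    hp₀_entropy ht.1 ht.2

theorem monotoneOn_condEntropy (hI : Convex ℝ I) (hI_zero : 0 ∈ I)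
    (hI_nonneg : ∀ t ∈ I, 0 ≤ t) (hsσ : IsNoiseSchedule I s σ)
    (hK : IsForwardKernel I (edmDrift s) (edmVolatility s σ) K) (hp₀ν : p₀ ≪ ν)
    (hp₀_moment : Integrable (fun x => ‖x‖ ^ 2) p₀)
    (hp₀_entropy : Integrable (fun x => Real.log (p₀.rnDeriv ν x).toReal) p₀) :
    MonotoneOn (fun t => condEntropy ν p₀ (K t)) (I ∩ Ioi 0) := by
  intro a ha b hb hab
  simp only [condEntropy_eq hI hI_zero hI_nonneg hsσ hK hp₀ν hp₀_moment hp₀_entropy ha.1 ha.2,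
    condEntropy_eq hI hI_zero hI_nonneg hsσ hK hp₀ν hp₀_moment hp₀_entropy hb.1 hb.2]
  exact sub_le_sub_right (monotoneOn_meanLogEvidence_inv hp₀_moment (hsσ.σ_pos hI_zero ha.1 ha.2)
    (hsσ.σ_pos hI_zero hb.1 hb.2) (hsσ.σ_strictMonoOn.monotoneOn ha.1 hb.1 hab)) _

theorem strictMonoOn_condEntropy (hI : Convex ℝ I) (hI_zero : 0 ∈ I)
    (hI_nonneg : ∀ t ∈ I, 0 ≤ t) (hsσ : IsNoiseSchedule I s σ)
    (hK : IsForwardKernel I (edmDrift s) (edmVolatility s σ) K) (hp₀ν : p₀ ≪ ν)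
    (hp₀_moment : Integrable (fun x => ‖x‖ ^ 2) p₀)
    (hp₀_entropy : Integrable (fun x => Real.log (p₀.rnDeriv ν x).toReal) p₀)
    (hp₀ : ∀ a, p₀ ≠ Measure.dirac a) :
    StrictMonoOn (fun t => condEntropy ν p₀ (K t)) (I ∩ Ioi 0) := by
  intro a ha b hb hab
  simp only [condEntropy_eq hI hI_zero hI_nonneg hsσ hK hp₀ν hp₀_moment hp₀_entropy ha.1 ha.2,
    condEntropy_eq hI hI_zero hI_nonneg hsσ hK hp₀ν hp₀_moment hp₀_entropy hb.1 hb.2]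
  exact sub_lt_sub_right (strictMonoOn_meanLogEvidence_inv hp₀_moment hp₀
    (hsσ.σ_pos hI_zero ha.1 ha.2) (hsσ.σ_pos hI_zero hb.1 hb.2)
    (hsσ.σ_strictMonoOn ha.1 hb.1 hab)) _

/-- The rescaled entropy is a function of the noise level. -/
theorem exists_rescaledEntropy_eq_comp (hI : Convex ℝ I) (hI_zero : 0 ∈ I)
    (hI_nonneg : ∀ t ∈ I, 0 ≤ t) (hsσ : IsNoiseSchedule I s σ)
    (hK : IsForwardKernel I (edmDrift s) (edmVolatility s σ) K) (hp₀ν : p₀ ≪ ν)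
    (hp₀_moment : Integrable (fun x => ‖x‖ ^ 2) p₀)
    (hp₀_entropy : Integrable (fun x => Real.log (p₀.rnDeriv ν x).toReal) p₀) :
    ∃ Φ : ℝ → ℝ, Continuous Φ ∧ (∀ u, 0 < u → HasDerivAt Φ (rescaledEntropyRate p₀ u) u) ∧
      ∀ t ∈ I, IntervalIntegrable (fun τ => σ τ * deriv (fun t => condEntropy ν p₀ (K t)) τ)
          volume 0 t ∧
        rescaledEntropy σ (fun t => condEntropy ν p₀ (K t)) t = Φ (σ t) - Φ 0 := by
  obtain ⟨Φ, hΦ, hΦ'⟩ := exists_primitive_of_bounded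
    (continuousOn_rescaledEntropyRate hp₀_moment) fun u _ => abs_rescaledEntropyRate_le p₀ u
  refine ⟨Φ, hΦ, hΦ', fun t ht => ?_⟩
  have ht0 := hI_nonneg t ht
  have hc : ContinuousOn (fun t => Φ (σ t)) (Icc 0 t) :=
    hΦ.comp_continuousOn (hsσ.σ_continuousOn.mono (hI.Icc_zero_subset hI_zero ht))
  have hderiv : ∀ τ ∈ Ioo 0 t, HasDerivAt (fun t => Φ (σ t))
      (σ τ * deriv (fun t => condEntropy ν p₀ (K t)) τ) τ ∧
      0 ≤ σ τ * deriv (fun t => condEntropy ν p₀ (K t)) τ := by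
    intro τ hτ
    have hτI := hI.Ioo_zero_subset_interior hI_zero ht hτ
    have hσ0 := hsσ.σ_pos hI_zero (interior_subset hτI) hτ.1
    -- The factor `σ τ` cancels the only singular factor `(σ τ)⁻¹` of the rate in the noise level.
    have e : σ τ * deriv (fun t => condEntropy ν p₀ (K t)) τ =
        rescaledEntropyRate p₀ (σ τ) * deriv σ τ := by
      rw [(hasDerivAt_condEntropy hI hI_zero hI_nonneg hsσ hK hp₀ν hp₀_moment hp₀_entropy
        hτI).deriv, mul_assoc, mul_inv_cancel_left₀ hσ0.ne']
    rw [e]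
    exact ⟨(hΦ' _ hσ0).comp τ (hsσ.hasDerivAt_σ hτI),
      mul_nonneg (rescaledEntropyRate_nonneg p₀ _) (hsσ.deriv_σ_nonneg hτI)⟩
  have hint : IntervalIntegrable (fun τ => σ τ * deriv (fun t => condEntropy ν p₀ (K t)) τ)
      volume 0 t := by
    -- Being the nonnegative derivative of a function continuous on `[0, t]`, the integrand is
    -- integrable without any bound on `deriv σ`.
    refine intervalIntegral.intervalIntegrable_deriv_of_nonneg (g := fun t => Φ (σ t))
      (by rwa [uIcc_of_le ht0]) (fun τ hτ => ?_) fun τ hτ => ?_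
    all_goals rw [min_eq_left ht0, max_eq_right ht0] at hτ
    exacts [(hderiv τ hτ).1, (hderiv τ hτ).2]
  refine ⟨hint, ?_⟩
  rw [rescaledEntropy, intervalIntegral.integral_eq_sub_of_hasDerivAt_of_le ht0 hc
    (fun τ hτ => (hderiv τ hτ).1) hint, hsσ.σ_zero]

end ConditionalEntropy

/-! ### Continuity of the discrete entropy at time 0. -/

section DiscreteEntropy

open Filter Topology

variable {d : ℕ} {I : Set ℝ} {s σ : ℝ → ℝ}
  {K : ℝ → Kernel (EuclideanSpace ℝ (Fin d)) (EuclideanSpace ℝ (Fin d))}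
  {S : Set (EuclideanSpace ℝ (Fin d))} {p₀ : Measure (EuclideanSpace ℝ (Fin d))}
  [SigmaFinite (Measure.count.restrict S)] [IsProbabilityMeasure p₀]

theorem ae_log_denoisingDensity_zero {b : EuclideanSpace ℝ (Fin d) → ℝ → EuclideanSpace ℝ (Fin d)}
    {g : ℝ → ℝ} (hI_zero : 0 ∈ I) (hK : IsForwardKernel I b g K) (hS : S.Countable)
    (hp₀ν : p₀ ≪ Measure.count.restrict S) :
    (fun z => Real.log (denoisingDensity (Measure.count.restrict S) p₀ (K 0) z).toReal)
      =ᵐ[p₀ ⊗ₘ K 0] fun _ => 0 := by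
  have := hK.markov 0 hI_zero
  filter_upwards [ae_rnDeriv_compProd_dirac_eq_one hS hp₀ν hK.initial] with z hz
  rw [denoisingDensity, hz, ENNReal.toReal_one, Real.log_one]

/-- Only time 0 is new. There the mean log evidence tends to exactly the constant subtracted in
`condEntropy_eq`, so the limit is 0, the entropy of noiseless data. -/
theorem continuousOn_condEntropy_discrete (hI : Convex ℝ I) (hI_zero : 0 ∈ I)
    (hI_nonneg : ∀ t ∈ I, 0 ≤ t) (hsσ : IsNoiseSchedule I s σ)
    (hK : IsForwardKernel I (edmDrift s) (edmVolatility s σ) K) (hS : S.Countable)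
    (hp₀ν : p₀ ≪ Measure.count.restrict S) (hp₀_moment : Integrable (fun x => ‖x‖ ^ 2) p₀)
    (hp₀_entropy :
      Integrable (fun x => Real.log (p₀.rnDeriv (Measure.count.restrict S) x).toReal) p₀) :
    ContinuousOn (fun t => condEntropy (Measure.count.restrict S) p₀ (K t)) I := by
  have hc := continuousOn_condEntropy hI hI_zero hI_nonneg hsσ hK hp₀ν hp₀_moment hp₀_entropy
  intro t ht
  rcases (hI_nonneg t ht).eq_or_lt with rfl | ht0
  swap
  · exact (continuousWithinAt_inter (Ioi_mem_nhds ht0)).1 (hc t ⟨ht, ht0⟩)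
  have hzero : condEntropy (Measure.count.restrict S) p₀ (K 0) = 0 := by
    rw [condEntropy, integral_congr_ae (ae_log_denoisingDensity_zero hI_zero hK hS hp₀ν)]
    simp
  have hρ := ae_rnDeriv_count_eq hS hp₀ν
  have hatom : ∀ᵐ a ∂p₀, p₀ {a} ≠ 0 := by
    filter_upwards [hρ, Measure.rnDeriv_pos hp₀ν] with a ha hpos
    rw [← ha]
    exact hpos.ne'
  have hent : Integrable (fun a => Real.log (p₀.real {a})) p₀ := by
    refine hp₀_entropy.congr ?_
    filter_upwards [hρ] with a ha
    rw [ha]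
    rfl
  have hlim := tendsto_meanLogEvidence hatom hent
  have e : ∫ w, (Real.log (p₀.real {w.1}) - ‖w.2‖ ^ 2 / 2)
        ∂p₀.prod (stdGaussian (EuclideanSpace ℝ (Fin d))) =
      ∫ w, (Real.log (p₀.rnDeriv (Measure.count.restrict S) w.1).toReal - ‖w.2‖ ^ 2 / 2)
        ∂p₀.prod (stdGaussian (EuclideanSpace ℝ (Fin d))) := by
    refine integral_congr_ae ?_
    filter_upwards [Measure.quasiMeasurePreserving_fst.ae hρ] with w hw
    rw [hw]
    rfl
  rw [← continuousWithinAt_sdiff_self]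
  have hpos : ∀ t ∈ I \ {0}, 0 < t := fun t ht => (hI_nonneg t ht.1).lt_of_ne (Ne.symm ht.2)
  have hσ : Tendsto σ (𝓝[I \ {0}] 0) (𝓝[>] 0) := by
    refine tendsto_nhdsWithin_iff.2 ⟨?_, ?_⟩
    · have h := ((hsσ.σ_continuousOn 0 hI_zero).mono (sdiff_subset (t := {0}))).tendsto
      rwa [hsσ.σ_zero] at h
    · filter_upwards [self_mem_nhdsWithin] with t ht
      exact hsσ.σ_pos hI_zero ht.1 (hpos t ht)
  have hmain := (hlim.comp (tendsto_inv_nhdsGT_zero.comp hσ)).sub_const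
    (∫ w, (Real.log (p₀.real {w.1}) - ‖w.2‖ ^ 2 / 2)
      ∂p₀.prod (stdGaussian (EuclideanSpace ℝ (Fin d))))
  rw [sub_self] at hmain
  rw [ContinuousWithinAt, hzero]
  refine hmain.congr' ?_
  filter_upwards [self_mem_nhdsWithin] with t ht
  rw [condEntropy_eq hI hI_zero hI_nonneg hsσ hK hp₀ν hp₀_moment hp₀_entropy ht.1 (hpos t ht), e]
  rfl

end DiscreteEntropy

/-! ### The main theorem. -/

theorem mainTheorem2 (d : ℕ)
    -- the time interval
    (I : Set ℝ) (hI : Convex ℝ I) (hI_zero : 0 ∈ I) (hI_nonneg : ∀ t ∈ I, 0 ≤ t)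
    -- the stochastic differential equation and its forward kernel
    (s σ : ℝ → ℝ) (hsσ : IsNoiseSchedule I s σ)
    (K : ℝ → Kernel (EuclideanSpace ℝ (Fin d)) (EuclideanSpace ℝ (Fin d)))
    (hK : IsForwardKernel I (edmDrift s) (edmVolatility s σ) K)
    -- the data distribution, with a density relative to the reference measure,
    -- a finite second moment and a finite entropy
    (ν p₀ : Measure (EuclideanSpace ℝ (Fin d))) [SigmaFinite ν] [IsProbabilityMeasure p₀]
    (hp₀ν : p₀ ≪ ν) (hp₀_moment : Integrable (fun x => ‖x‖ ^ 2) p₀)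
    (hp₀_entropy : Integrable (fun x => Real.log (p₀.rnDeriv ν x).toReal) p₀)
    -- the times at which the conditional entropy is considered: the positive ones in general,
    -- all of them for discrete data
    (J : Set ℝ)
    (hJ : J = I ∩ Ioi 0 ∨
      J = I ∧ ∃ S : Set (EuclideanSpace ℝ (Fin d)), S.Countable ∧ ν = Measure.count.restrict S) :
    -- the conditional entropy and the rescaled entropy are well defined
    (∀ t ∈ J, Integrable (fun z => Real.log (denoisingDensity ν p₀ (K t) z).toReal)
      (p₀ ⊗ₘ K t)) ∧
    (∀ t ∈ interior I, DifferentiableAt ℝ (fun t => condEntropy ν p₀ (K t)) t) ∧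
    (∀ t ∈ I, IntervalIntegrable (fun τ => σ τ * deriv (fun t => condEntropy ν p₀ (K t)) τ)
      volume 0 t) ∧
    -- they are continuous and nondecreasing
    ContinuousOn (fun t => condEntropy ν p₀ (K t)) J ∧
    MonotoneOn (fun t => condEntropy ν p₀ (K t)) J ∧
    ContinuousOn (rescaledEntropy σ (fun t => condEntropy ν p₀ (K t))) I ∧
    MonotoneOn (rescaledEntropy σ (fun t => condEntropy ν p₀ (K t))) I ∧
    -- they are proper time changes unless the data is a single point
    ((∀ a, p₀ ≠ Measure.dirac a) →
      IsProperTimeChange (fun t => condEntropy ν p₀ (K t)) J ∧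
      IsProperTimeChange (rescaledEntropy σ (fun t => condEntropy ν p₀ (K t))) I) := by
  obtain ⟨Φ, hΦ, hΦ', hR⟩ := exists_rescaledEntropy_eq_comp hI hI_zero hI_nonneg hsσ hK hp₀ν
    hp₀_moment hp₀_entropy
  have hσ_maps : MapsTo σ I (Ici 0) := fun t ht => hsσ.σ_nonneg hI_zero hI_nonneg ht
  have hR_cont : ContinuousOn (rescaledEntropy σ (fun t => condEntropy ν p₀ (K t))) I :=
    ((hΦ.comp_continuousOn hsσ.σ_continuousOn).sub continuousOn_const).congr fun t ht => (hR t ht).2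
  have hΦ_mono : MonotoneOn Φ (Ici 0) := by
    refine monotoneOn_of_hasDerivWithinAt_nonneg (convex_Ici 0) hΦ.continuousOn
      (f' := rescaledEntropyRate p₀) (fun u hu => ?_)
      fun u _ => rescaledEntropyRate_nonneg p₀ u
    rw [interior_Ici] at hu
    exact (hΦ' u hu).hasDerivWithinAt
  have hR_mono : MonotoneOn (rescaledEntropy σ (fun t => condEntropy ν p₀ (K t))) I := by
    intro a ha b hb hab
    rw [(hR a ha).2, (hR b hb).2]
    exact sub_le_sub_right (hΦ_mono (hσ_maps ha) (hσ_maps hb)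
      (hsσ.σ_strictMonoOn.monotoneOn ha hb hab)) _
  have hR_strict : (∀ a, p₀ ≠ Measure.dirac a) →
      StrictMonoOn (rescaledEntropy σ (fun t => condEntropy ν p₀ (K t))) I := by
    intro hp₀ a ha b hb hab
    -- Since `deriv σ` may vanish, strictness is obtained in the noise level and then composed with
    -- the strictly increasing `σ`.
    have hΦ_strict : StrictMonoOn Φ (Ici 0) := by
      refine strictMonoOn_of_deriv_pos (convex_Ici 0) hΦ.continuousOn fun u hu => ?_
      rw [interior_Ici] at hu
      rw [(hΦ' u hu).deriv]
      exact rescaledEntropyRate_pos hp₀ hu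
    rw [(hR a ha).2, (hR b hb).2]
    exact sub_lt_sub_right (hΦ_strict (hσ_maps ha) (hσ_maps hb) (hsσ.σ_strictMonoOn ha hb hab)) _
  have hint := fun t (ht : t ∈ I) (ht0 : 0 < t) => integrable_log_denoisingDensity hI hI_zero
    hI_nonneg hsσ hK hp₀ν hp₀_moment hp₀_entropy ht ht0
  have hH_mono := monotoneOn_condEntropy hI hI_zero hI_nonneg hsσ hK hp₀ν hp₀_moment hp₀_entropy
  have hH_strict := strictMonoOn_condEntropy hI hI_zero hI_nonneg hsσ hK hp₀ν hp₀_moment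
    hp₀_entropy
  have hJ_all : (∀ t ∈ J, Integrable (fun z => Real.log (denoisingDensity ν p₀ (K t) z).toReal)
        (p₀ ⊗ₘ K t)) ∧ ContinuousOn (fun t => condEntropy ν p₀ (K t)) J ∧
      MonotoneOn (fun t => condEntropy ν p₀ (K t)) J ∧
      ((∀ a, p₀ ≠ Measure.dirac a) → StrictMonoOn (fun t => condEntropy ν p₀ (K t)) J) := by
    rcases hJ with rfl | ⟨rfl, S, hS, rfl⟩
    · exact ⟨fun t ht => hint t ht.1 ht.2, continuousOn_condEntropy hI hI_zero hI_nonneg hsσ hK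
        hp₀ν hp₀_moment hp₀_entropy, hH_mono, hH_strict⟩
    · have hc := continuousOn_condEntropy_discrete hI hI_zero hI_nonneg hsσ hK hS hp₀ν hp₀_moment
        hp₀_entropy
      refine ⟨fun t ht => ?_, hc, monotoneOn_of_inter_Ioi hI hI_zero hI_nonneg hc hH_mono,
        fun hp₀ => strictMonoOn_of_inter_Ioi hI hI_zero hI_nonneg hc (hH_strict hp₀)⟩
      rcases (hI_nonneg t ht).eq_or_lt with rfl | ht0
      · exact (integrable_zero _ _ _).congr
          (ae_log_denoisingDensity_zero hI_zero hK hS hp₀ν).symm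
      · exact hint t ht ht0
  obtain ⟨hJ_int, hJ_cont, hJ_mono, hJ_strict⟩ := hJ_all
  exact ⟨hJ_int, fun t ht => (hasDerivAt_condEntropy hI hI_zero hI_nonneg hsσ hK hp₀ν hp₀_moment
    hp₀_entropy ht).differentiableAt, fun t ht => (hR t ht).1, hJ_cont, hJ_mono, hR_cont, hR_mono,
    fun hp₀ => ⟨⟨hJ_cont, hJ_strict hp₀⟩, ⟨hR_cont, hR_strict hp₀⟩⟩⟩
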